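/- **Setting.** Let $K$ be an algebraically closed field and $S=K[x_0,\dots,x_n]$ with $x_0<\dots<x_n$. For a monomial ideal $J\subseteq S$ let $B_J$ be its minimal monomial generating set, $\mathcal N(J)$ the set of monomials not in $J$, and $J_{\ge m}$ ($m\in\mathbb Z$) the ideal generated by the homogeneous elements of $J$ of degree $\ge m$. $J$ is *strongly stable* if $x^\alpha\in J$, $x_i\mid x^\alpha$ and $i<j$ imply $x^\alpha x_j/x_i\in J$; it is *saturated* if it contains every $f\in S$ such that for each $j$ some $x_j^{r}f$ lies in $J$. For strongly stable $J$ take parameters $C=\{C_{\alpha\gamma}: x^\alpha\in B_J,\ x^\gamma\in\mathcal N(J),\ |\gamma|=|\alpha|\}$ and $F_\alpha=x^\alpha-\sum_\gamma C_{\alpha\gamma}x^\gamma$. Let $\mathfrak A_J\subseteq K[C]$ be the ideal generated by the $x$-coefficients of the $J$-reduced forms (all monomials in $\mathcal N(J)$) of the S-polynomials of the $F_\alpha$, obtained by reducing with the polynomials $x^\delta F_\alpha$ such that $x^\delta=1$ or $\max(x^\delta)\le\min(x^\alpha)$. The *$J$-marked scheme* is $\mathrm{Mf}(J)=\operatorname{Spec}K[C]/\mathfrak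 A_J\subseteq\mathbb A^{|C|}$; $T_0(\mathrm{Mf}(J))$ denotes its Zariski tangent space at the origin. For a monomial $x^\alpha$ let $x^{\underline\alpha}$ be the monomial obtained by putting $x_0=1$, and let $\underline J$ be the ideal generated by the $x^{\underline\alpha}$ with $x^\alpha\in B_J$. Let $sB_J=\{x^\alpha\in B_J: x^{\underline\alpha}\in B_{\underline{J}}\}$, and let $\widetilde C\subseteq C$ be the set of the $C_{\alpha\gamma}$ with $x^\alpha\in sB_J$. Projecting gives a morphism $\mathrm{Mf}(J)\to\mathbb A^{|C|}\to\mathbb A^{|\widetilde C|}$. **Theorem.** Let $\underline J\subseteq S$ be a saturated strongly stable ideal. For $m\in\mathbb Z$ write $C^{[m]},\widetilde C^{[m]}$ for the sets $C,\widetilde C$ of the ideal $\underline J_{\ge m}$. (If $\underline J$ is saturated and strongly stable, it is its own $\underline{\,\cdot\,}$, which justifies the notation.) Then, for every $m\in\mathbb Z$: (i) The set $\widetilde C^{[m-1]}$ is identified with a subset of $\widetilde C^{[m]}$ by the injection that sends $C_{\alpha\delta}$ to $C_{\alpha\delta}$ if $|\alpha|\ge m$, and to the coefficient of $x_0x^\delta$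 in the tail of the polynomial with head term $x_0x^\alpha$ if $|\alpha|=m-1$. There is a morphism $\phi_m$ of $K$-schemes making the diagram $$\begin{array}{ccc}\mathrm{Mf}(\underline J_{\ge m-1})&\xrightarrow{\ \phi_m\ }&\mathrm{Mf}(\underline J_{\ge m})\\ \downarrow&&\downarrow\\ \mathbb A^{|\widetilde C^{[m-1]}|}&\longrightarrow&\mathbb A^{|\widetilde C^{[m]}|}\end{array}$$ commute, where the bottom arrow is the inclusion of the coordinate subspace defined by the identification, and all four arrows are closed embeddings. Moreover $\mathrm{Mf}(\underline J_{\ge m-1})$ is cut out in $\mathrm{Mf}(\underline J_{\ge m})$ by a linear space compatible with these embeddings: there is a coordinate linear subspace $\Lambda=V(C_{\beta\gamma}: C_{\beta\gamma}\in Z)\subseteq\mathbb A^{|C^{[m]}|}$, $Z\subseteq C^{[m]}$, such that $Z\cap\widetilde C^{[m]}=\widetilde C^{[m]}\setminus\widetilde C^{[m-1]}$ (so $\Lambda$ projects onto $\mathbb A^{|\widetilde C^{[m-1]}|}\subseteq\mathbb A^{|\widetilde C^{[m]}|}$) and, via $\phi_m$, $\mathrm{Mf}(\underline J_{\ge m-1})$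 is the scheme-theoretic intersection $\mathrm{Mf}(\underline J_{\ge m})\cap\Lambda$. (ii) If $\Omega$ is the number of monomials of degree $m+1$ in $B_{\underline J}$ divisible by $x_1$, and $\Theta$ the number of monomials of degree $\le m-1$ in $B_{\underline J}$, then $$\dim T_0(\mathrm{Mf}(\underline J_{\ge m}))\ \ge\ \dim T_0(\mathrm{Mf}(\underline J_{\ge m-1}))+\Omega\cdot\Theta .$$ (iii) The following are equivalent: $\phi_m$ is an isomorphism; $\mathrm{Mf}(\underline J_{\ge m-1})\simeq\mathrm{Mf}(\underline J_{\ge m})$ as $K$-schemes; either $\underline J_{\ge m-1}=\underline J_{\ge m}$ or no monomial of degree $m+1$ in $B_{\underline J}$ is divisible by $x_1$. In particular, if $\rho$ is the maximal degree of a monomial of $B_{\underline J}$ divisible by $x_1$ ($\rho=0$ if there is none), then $\mathrm{Mf}(\underline J_{\ge\rho-1})\simeq\mathrm{Mf}(\underline J_{\ge m})$ for every $m\ge\rho$. -/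

import Mathlib

open CategoryTheory AlgebraicGeometry

noncomputable section

namespace Marked

universe u

/-- Exponents of the monomials in `x_0, …, x_n`; the variables are ordered `x_0 < … < x_n`. -/
abbrev Mon (n : ℕ) : Type := Fin (n + 1) →₀ ℕ

/-! ### Monomial ideals of `K[x_0, …, x_n]` -/

section Ideals

variable {K : Type u} [Field K] {n : ℕ}

/-- The exponents of the monomials that belong to the ideal `J`;
its complement is the sous-escalier `N(J)`. -/
def mons (J : Ideal (MvPolynomial (Fin (n + 1)) K)) : Set (Mon n) :=
  {α | MvPolynomial.monomial α (1 : K) ∈ J}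

/-- `J` is generated by monomials. -/
def IsMonomialIdeal (J : Ideal (MvPolynomial (Fin (n + 1)) K)) : Prop :=
  ∃ s : Set (Mon n), J = Ideal.span ((fun α => MvPolynomial.monomial α (1 : K)) '' s)

/-- The monomial basis `B_J`: the monomials of `J` that are minimal for divisibility. -/
def basisMons (J : Ideal (MvPolynomial (Fin (n + 1)) K)) : Set (Mon n) :=
  {α | α ∈ mons J ∧ ∀ β ∈ mons J, β ≤ α → β = α}

/-- `x^β` is obtained from `x^α` by an increasing elementary move:
`x^α x_j = x^β x_i` with `i < j`. -/
def IncreasingMove (α β : Mon n) : Prop :=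
  ∃ i j : Fin (n + 1), i < j ∧ α + Finsupp.single j 1 = β + Finsupp.single i 1

/-- `x^β >_B x^α` in the Borel partial order. -/
def BorelGT (β α : Mon n) : Prop :=
  Relation.TransGen IncreasingMove α β

/-- Strongly stable (monomial) ideals. -/
def StronglyStable (J : Ideal (MvPolynomial (Fin (n + 1)) K)) : Prop :=
  IsMonomialIdeal J ∧ ∀ α β : Mon n, BorelGT β α → α ∈ mons J → β ∈ mons J

/-- `J` is saturated: it contains every `f` such that for all `j` some `x_j ^ r * f` is in `J`. -/
def IsSaturated (J : Ideal (MvPolynomial (Fin (n + 1)) K)) : Prop :=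
  ∀ f : MvPolynomial (Fin (n + 1)) K,
    (∀ j : Fin (n + 1), ∃ r : ℕ, MvPolynomial.X j ^ r * f ∈ J) → f ∈ J

/-- The truncation `J_{≥ m}`: the ideal generated by the homogeneous elements of `J` whose degree
is at least `m`. -/
def truncation (J : Ideal (MvPolynomial (Fin (n + 1)) K)) (m : ℤ) :
    Ideal (MvPolynomial (Fin (n + 1)) K) :=
  Ideal.span {f | f ∈ J ∧ ∃ d : ℕ, m ≤ (d : ℤ) ∧ f.IsHomogeneous d}

/-- The ideal generated by the monomials obtained from those of `B_J` by putting `x_0 = 1`. -/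
def underlineIdeal (J : Ideal (MvPolynomial (Fin (n + 1)) K)) :
    Ideal (MvPolynomial (Fin (n + 1)) K) :=
  Ideal.span ((fun α : Mon n => MvPolynomial.monomial (α.erase 0) (1 : K)) '' basisMons J)

/-- The set `sB_J` of superminimal generators. -/
def superminimals (J : Ideal (MvPolynomial (Fin (n + 1)) K)) : Set (Mon n) :=
  {β | β ∈ basisMons J ∧ β.erase 0 ∈ basisMons (underlineIdeal J)}

/-! ### The universal `J`-marked set and the ideal `𝔄_J` -/

/-- The parameters `C_{αγ}`: pairs `(α, γ)` with `x^α ∈ B_J`, `x^γ ∈ N(J)`, `|γ| = |α|`. -/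
def Param (J : Ideal (MvPolynomial (Fin (n + 1)) K)) : Type :=
  {p : Mon n × Mon n // p.1 ∈ basisMons J ∧ p.2 ∉ mons J ∧ p.2.degree = p.1.degree}

/-- The parameters occurring in the tails of the superminimals (the set `C̃`). -/
def SParam (J : Ideal (MvPolynomial (Fin (n + 1)) K)) : Type :=
  {c : Param J // c.1.1 ∈ superminimals J}

open Classical in
/-- `F_α = x^α - ∑ C_{αγ} x^γ`, the sum being over the `x^γ ∈ N(J)` of degree `|α|`,
as a polynomial in the `x_i` with coefficients in `K[C]`. -/
def genericPoly (J : Ideal (MvPolynomial (Fin (n + 1)) K)) (α : Mon n) :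
    MvPolynomial (Fin (n + 1)) (MvPolynomial (Param J) K) :=
  MvPolynomial.monomial α 1 -
    ∑ γ ∈ Finset.finsuppAntidiag Finset.univ α.degree,
      if h : α ∈ basisMons J ∧ γ ∉ mons J ∧ γ.degree = α.degree then
        MvPolynomial.monomial γ (MvPolynomial.X (⟨(α, γ), h⟩ : Param J))
      else 0

/-- The S-polynomial of `F_α` and `F_β`; the least common multiple has exponent `α ⊔ β`. -/
def sPoly (J : Ideal (MvPolynomial (Fin (n + 1)) K)) (α β : Mon n) :
    MvPolynomial (Fin (n + 1)) (MvPolynomial (Param J) K) :=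
  MvPolynomial.monomial (α ⊔ β - α) 1 * genericPoly J α -
    MvPolynomial.monomial (α ⊔ β - β) 1 * genericPoly J β

/-- One step of the reduction by the polynomials `x^δ F_α` with `x^α ∈ B_J` and
`x^δ = 1` or `max (x^δ) ≤ min (x^α)`: the monomial `x^(δ+α)`, which occurs in `h` with the non-zero
coefficient `c`, is cancelled by subtracting `c x^δ F_α`. -/
def ReductionStep (J : Ideal (MvPolynomial (Fin (n + 1)) K))
    (h h' : MvPolynomial (Fin (n + 1)) (MvPolynomial (Param J) K)) : Prop :=
  ∃ α ∈ basisMons J, ∃ δ : Mon n,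
    (∀ i ∈ δ.support, ∀ j ∈ α.support, i ≤ j) ∧
    h.coeff (δ + α) ≠ 0 ∧
    h' = h - MvPolynomial.monomial δ (h.coeff (δ + α)) * genericPoly J α

/-- `h` is `J`-reduced: all monomials of its support are in `N(J)`. -/
def IsReducedPoly (J : Ideal (MvPolynomial (Fin (n + 1)) K))
    (h : MvPolynomial (Fin (n + 1)) (MvPolynomial (Param J) K)) : Prop :=
  ∀ γ ∈ h.support, γ ∉ mons J

/-- The ideal `𝔄_J ⊆ K[C]` generated by the `x`-coefficients of the `J`-reduced forms of the
S-polynomials of the `F_α`. -/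
def markedIdeal (J : Ideal (MvPolynomial (Fin (n + 1)) K)) : Ideal (MvPolynomial (Param J) K) :=
  Ideal.span {a | ∃ α ∈ basisMons J, ∃ β ∈ basisMons J, ∃ H,
    Relation.ReflTransGen (ReductionStep J) (sPoly J α β) H ∧ IsReducedPoly J H ∧
    ∃ γ : Mon n, a = H.coeff γ}

end Ideals

/-! ### Affine `K`-schemes -/

section Schemes

variable (K : Type u) [Field K]

/-- `Spec R` as a scheme over `Spec K`. -/
def specOver (R : Type u) [CommRing R] [Algebra K R] : Over (Spec (CommRingCat.of K)) :=
  Over.mk (Spec.map (CommRingCat.ofHom (algebraMap K R)))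

variable {K}

/-- The morphism of `K`-schemes given by a homomorphism of `K`-algebras. -/
def specOverMap {R S : Type u} [CommRing R] [Algebra K R] [CommRing S] [Algebra K S]
    (f : R →ₐ[K] S) : specOver K S ⟶ specOver K R :=
  Over.homMk (Spec.map (CommRingCat.ofHom f.toRingHom)) (by
    simp only [specOver, Over.mk_left, Over.mk_hom, ← Spec.map_comp, ← CommRingCat.ofHom_comp]
    congr 2
    exact f.comp_algebraMap)

variable (K) in
/-- The affine space with coordinates indexed by `σ`. -/
def affineSpace (σ : Type) : Over (Spec (CommRingCat.of K)) :=
  specOver K (MvPolynomial σ K)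

/-- The closed subscheme of affine space defined by the ideal `a`. -/
def closedSub {σ : Type} (a : Ideal (MvPolynomial σ K)) : Over (Spec (CommRingCat.of K)) :=
  specOver K (MvPolynomial σ K ⧸ a)

/-- The inclusion into affine space of the closed subscheme defined by `a`. -/
def closedSubIncl {σ : Type} (a : Ideal (MvPolynomial σ K)) : closedSub a ⟶ affineSpace K σ :=
  specOverMap (Ideal.Quotient.mkₐ K a)

/-- The ideal of the coordinate linear subspace on which the coordinates in `Z` vanish. -/
def coordIdeal (K : Type u) [Field K] {σ : Type} (Z : Set σ) : Ideal (MvPolynomial σ K) :=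
  Ideal.span (MvPolynomial.X '' Z)

/-- For an injection `ι : σ ↪ τ`, the inclusion of the affine space on `σ` into the affine space on
`τ` as a coordinate subspace: the coordinate `ι s` restricts to the coordinate `s`, and the
coordinates outside the range of `ι` restrict to zero. -/
def coordIncl (K : Type u) [Field K] {σ τ : Type} (ι : σ ↪ τ) :
    affineSpace K σ ⟶ affineSpace K τ :=
  specOverMap (MvPolynomial.aeval
    (Function.extend ι (MvPolynomial.X : σ → MvPolynomial σ K) 0))

/-- The linear part of `f` evaluated at `v`. -/
def linearPart {σ : Type} (f : MvPolynomial σ K) : (σ → K) →ₗ[K] K :=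
  ∑ i ∈ f.vars, f.coeff (Finsupp.single i 1) • LinearMap.proj i

/-- The Zariski tangent space at the origin of the closed subscheme defined by `a` (for an ideal
`a` of polynomials vanishing at the origin): the zero locus of the linear parts of the elements
of `a`. -/
def tangentAtOrigin {σ : Type} (a : Ideal (MvPolynomial σ K)) : Submodule K (σ → K) :=
  ⨅ f ∈ a, LinearMap.ker (linearPart f)

end Schemes

/-! ### Marked schemes -/

section MarkedSchemes

variable {K : Type u} [Field K] {n : ℕ}

/-- The `J`-marked scheme `Mf(J)`, the closed subscheme of `𝔸^C` defined by `𝔄_J`. -/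
def Mf (J : Ideal (MvPolynomial (Fin (n + 1)) K)) : Over (Spec (CommRingCat.of K)) :=
  closedSub (markedIdeal J)

/-- The inclusion of `Mf(J)` into `𝔸^C`. -/
def bigEmb (J : Ideal (MvPolynomial (Fin (n + 1)) K)) : Mf J ⟶ affineSpace K (Param J) :=
  closedSubIncl (markedIdeal J)

/-- The projection `𝔸^C ⟶ 𝔸^C̃` that forgets the parameters not in `C̃`. -/
def projSmall (J : Ideal (MvPolynomial (Fin (n + 1)) K)) :
    affineSpace K (Param J) ⟶ affineSpace K (SParam J) :=
  specOverMap (MvPolynomial.rename Subtype.val)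

/-- The morphism of `Mf(J)` to the small affine space `𝔸^C̃`. It corresponds to
`K[C̃] → K[C] / 𝔄_J`, so that its scheme-theoretic image is defined by `𝔄_J ∩ K[C̃]`. -/
def smallEmb (J : Ideal (MvPolynomial (Fin (n + 1)) K)) : Mf J ⟶ affineSpace K (SParam J) :=
  bigEmb J ≫ projSmall J

/-- The number of monomials of degree `m + 1` in `B_J` that are divisible by `x_1`. -/
def Omega (J : Ideal (MvPolynomial (Fin (n + 1)) K)) (m : ℤ) : ℕ :=
  {α | α ∈ basisMons J ∧ (α.degree : ℤ) = m + 1 ∧ α 1 ≠ 0}.ncard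

/-- The number of monomials of degree at most `m - 1` in `B_J`. -/
def Theta (J : Ideal (MvPolynomial (Fin (n + 1)) K)) (m : ℤ) : ℕ :=
  {α | α ∈ basisMons J ∧ (α.degree : ℤ) ≤ m - 1}.ncard

/-- The maximal degree of a monomial of `B_J` divisible by `x_1` (`0` if there is none). -/
def rho (J : Ideal (MvPolynomial (Fin (n + 1)) K)) : ℕ :=
  sSup {d | ∃ α ∈ basisMons J, α 1 ≠ 0 ∧ α.degree = d}

/-- The identification of the parameters `C̃` of `J_{≥ m-1}` with parameters `C̃` of `J_{≥ m}`:
`C_{αδ}` goes to `C_{αδ}` if `|α| ≥ m`, and to the coefficient of `x_0 x^δ` in the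
tail of the polynomial with head `x_0 x^α` if `|α| = m - 1`. -/
def IsParamIdentification (J : Ideal (MvPolynomial (Fin (n + 1)) K)) (m : ℤ)
    (ι : SParam (truncation J (m - 1)) ↪ SParam (truncation J m)) : Prop :=
  ∀ c : SParam (truncation J (m - 1)),
    (m ≤ (c.1.1.1.degree : ℤ) → (ι c).1.1 = c.1.1) ∧
    ((c.1.1.1.degree : ℤ) = m - 1 →
      (ι c).1.1 = (c.1.1.1 + Finsupp.single 0 1, c.1.1.2 + Finsupp.single 0 1))

end MarkedSchemes

end Marked

end

noncomputable section

namespace Marked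

universe u

/-! ### Star decompositions of the monomials of a strongly stable ideal -/

section Monomials

variable {K : Type u} [Field K] {n : ℕ} {J : Ideal (MvPolynomial (Fin (n + 1)) K)}

/-! `Mf(J)` is treated as a functor. A `K`-algebra homomorphism from its coordinate ring to `A` is a
choice of tails over `A` for which the `F_α` form a marked basis: the ideal they generate contains
no nonzero combination of monomials of `N(J)` (`markedIdeal_le_ker_iff`). This is a Buchberger
criterion. Every monomial of `J` is uniquely `x^δ x^α` with `x^α ∈ B_J` and `max x^δ ≤ min x^α`, and
reduction creates only monomials with colexicographically smaller cofactors (`IsStar.toColex_lt`).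
So reduction terminates, the span of the products `x^δ F_α` meets the normal forms only in zero, and
this span is the whole ideal once the S-polynomials reduce to zero. The theorem then becomes a set
of statements about marked bases over the universal coordinate ring, an arbitrary algebra, or the
dual numbers.

Let `J` now be the saturated ideal. In degrees at least `m` the normal forms for `J_{≥ m}` are those
for `J`, and by saturation multiplication by `x_0` preserves them. A marked basis of `J_{≥ m-1}`
induces one of `J_{≥ m}` by taking normal forms of the generators, and uniqueness forces `F_{x_0
x^α} = x_0 F_α` when `|α| = m - 1`. Conversely, if all tails with such heads `x_0 x^α` are divisible
by `x_0`, cancelling `x_0` recovers a marked basis of `J_{≥ m-1}` (`isMarkedBasis_shift`,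
`markedPoly_mem_markedSpan_shift`). So `Λ` is the vanishing locus of `cutParams`. After
multiplication by powers of `x_0`, superminimals alone suffice to reduce any monomial, so their
coefficients generate the coordinate ring (`IsMarkedBasis.apply_mem`); this gives the embeddings in
the small affine spaces.

If `x^β ∈ B_J` has degree `m + 1` and `x_1 ∣ x^β`, then `x^γ = x^β / x_1` is outside `J` but `x_i
x^γ ∈ J` for all `i ≥ 1`. Therefore replacing one generator `x_0^k x^α` by `x_0^k x^α - ε x^γ` gives
a marked basis whenever `ε² = 0` (`isMarkedBasis_single`). These `Ω · Θ` coordinate directions are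
transversal to `Λ`, which gives the tangent bound and shows that some cut parameter is nonzero when
`Ω` and `Θ` are positive. If `Ω = 0`, comparing `x_1 F_{x_0 x^α}` with `x_0 F_{x_1 x^α}` kills all
cut parameters (`apply_cutParams_eq_zero`). An abstract isomorphism is no weaker than `φ_m` being
one, because a surjective endomorphism of a Noetherian ring is injective. -/

theorem mons_of_le {α β : Mon n} (hα : α ∈ mons J) (h : α ≤ β) : β ∈ mons J := by
  have := J.mul_mem_left (MvPolynomial.monomial (β - α) (1 : K)) hα
  rwa [MvPolynomial.monomial_mul, one_mul, tsub_add_cancel_of_le h] at this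

theorem mons_add {α : Mon n} (hα : α ∈ mons J) (δ : Mon n) : δ + α ∈ mons J :=
  mons_of_le hα le_add_self

/-- The exponents of the monomials of `J` are stable under increasing moves. -/
def StableMons (J : Ideal (MvPolynomial (Fin (n + 1)) K)) : Prop :=
  ∀ α β : Mon n, IncreasingMove α β → α ∈ mons J → β ∈ mons J

theorem StronglyStable.stableMons (h : StronglyStable J) : StableMons J :=
  fun α β hm => h.2 α β (Relation.TransGen.single hm)

theorem exists_basisMons_le {α : Mon n} (hα : α ∈ mons J) : ∃ β ∈ basisMons J, β ≤ α := by
  obtain ⟨β, ⟨hβ, hle⟩, hmin⟩ :=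
    (wellFounded_lt (α := Mon n)).has_min {β | β ∈ mons J ∧ β ≤ α} ⟨α, hα, le_rfl⟩
  refine ⟨β, ⟨hβ, fun γ hγ hγβ => ?_⟩, hle⟩
  by_contra hne
  exact hmin γ ⟨hγ, hγβ.trans hle⟩ (lt_of_le_of_ne hγβ hne)

/-- The product `x^δ x^α` is the star decomposition of an element of `J`: `x^α` is in the monomial
basis of `J` and `max x^δ ≤ min x^α`. -/
def IsStar (J : Ideal (MvPolynomial (Fin (n + 1)) K)) (δ α : Mon n) : Prop :=
  α ∈ basisMons J ∧ ∀ i ∈ δ.support, ∀ j ∈ α.support, i ≤ j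

theorem IsStar.mem {δ α : Mon n} (h : IsStar J δ α) : δ + α ∈ mons J :=
  mons_add h.1.1 δ

/-- Peel off the smallest variable `x_i` while the quotient stays in `J`. When it no longer does,
the monomial is a minimal generator: a quotient by some `x_j` with `j > i` lying in `J` would, by an
increasing move, put the quotient by `x_i` in `J`. -/
theorem exists_isStar (hS : StableMons J) (μ : Mon n) (hμ : μ ∈ mons J) :
    ∃ δ α, IsStar J δ α ∧ δ + α = μ := by
  induction μ using WellFoundedLT.induction with
  | ind μ ih =>
    by_cases hb : μ ∈ basisMons J
    · exact ⟨0, μ, ⟨hb, by simp⟩, zero_add _⟩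
    have h0 : μ.support.Nonempty := by
      rw [Finset.nonempty_iff_ne_empty, Ne, Finsupp.support_eq_empty]
      rintro rfl
      exact hb ⟨hμ, fun β _ h => le_antisymm h (zero_le)⟩
    set i := μ.support.min' h0 with hi
    have himem : i ∈ μ.support := Finset.min'_mem _ _
    have hsub : ∀ j ∈ μ.support, μ - Finsupp.single j 1 + Finsupp.single j 1 = μ := fun j hj =>
      tsub_add_cancel_of_le (Finsupp.single_le_iff.2
        (Nat.one_le_iff_ne_zero.2 (Finsupp.mem_support_iff.1 hj)))
    by_cases hm : μ - Finsupp.single i 1 ∈ mons J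
    · have hlt : μ - Finsupp.single i 1 < μ := by
        refine lt_of_le_of_ne tsub_le_self fun h => ?_
        have := DFunLike.congr_fun (hsub i himem) i
        rw [h] at this
        simp at this
      obtain ⟨δ, α, hs, hadd⟩ := ih _ hlt hm
      refine ⟨δ + Finsupp.single i 1, α, ⟨hs.1, fun k hk j hj => ?_⟩, ?_⟩
      · have hjμ : j ∈ μ.support := by
          have h1 : α ≤ μ := (le_add_self.trans_eq hadd).trans tsub_le_self
          exact Finsupp.support_mono h1 hj
        rcases Finset.mem_union.1 (Finsupp.support_add hk) with hk | hk
        · exact hs.2 k hk j hj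
        · rw [Finset.mem_singleton.1 (Finsupp.support_single_subset hk)]
          exact Finset.min'_le _ _ hjμ
      · rw [add_right_comm, hadd, hsub i himem]
    · refine absurd ⟨hμ, fun β hβ hle => ?_⟩ hb
      by_contra hne
      obtain ⟨j, hj⟩ : ∃ j, β j < μ j := by
        by_contra! hcon
        exact hne (le_antisymm hle hcon)
      have hjμ : j ∈ μ.support := Finsupp.mem_support_iff.2 (by omega)
      have hle' : β ≤ μ - Finsupp.single j 1 := by
        intro k
        have := hle k
        by_cases hk : j = k
        · subst hk; simp; omega
        · simpa [Finsupp.single_apply, hk] using this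
      have hmem := mons_of_le hβ hle'
      have hij : i ≤ j := Finset.min'_le _ _ hjμ
      rcases hij.eq_or_lt with h | h
      · exact hm (h ▸ hmem)
      · exact hm (hS _ _ ⟨i, j, h, by rw [hsub j hjμ, hsub i himem]⟩ hmem)

/-- The star decomposition of `x^ε x^μ` has a smaller cofactor than `x^ε`, unless its head
divides `x^μ`. -/
theorem IsStar.toColex_lt {δ α ε μ : Mon n} (h : IsStar J δ α) (hadd : ε + μ = δ + α)
    (hμ : ¬ α ≤ μ) : toColex δ < toColex ε := by
  by_contra hlt
  apply hμ
  -- If `δ` exceeds `ε` at their last difference `j`, the star condition makes `α` vanish below `j`,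
  -- so `δ = ε + μ` there. The colexicographic inequality thus becomes divisibility.
  have key : ε ≤ δ := by
    rcases (not_lt.1 hlt).eq_or_lt with h' | h'
    · exact (toColex.injective h').le
    · obtain ⟨j, hj, hjlt⟩ := Finsupp.Colex.lt_iff.1 h'
      have hjlt' : ε j < δ j := hjlt
      intro i
      rcases lt_trichotomy i j with hij | rfl | hij
      · have hα : α i = 0 := by
          by_contra h0
          exact absurd (h.2 j (Finsupp.mem_support_iff.2 (by omega)) i
            (Finsupp.mem_support_iff.2 h0)) (not_le.2 hij)
        have := DFunLike.congr_fun hadd i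
        simp only [Finsupp.add_apply] at this
        omega
      · exact hjlt'.le
      · exact (hj i hij).le
  intro i
  have h1 := DFunLike.congr_fun hadd i
  have h2 := key i
  simp only [Finsupp.add_apply] at h1
  omega

theorem IsStar.unique {δ α δ' α' : Mon n} (h : IsStar J δ α) (h' : IsStar J δ' α')
    (hadd : δ + α = δ' + α') : δ = δ' ∧ α = α' := by
  have hα : α = α' := by
    by_contra hne
    have h1 := h'.toColex_lt hadd fun hle => hne (h.1.2 _ h'.1.1 hle).symm
    have h2 := h.toColex_lt hadd.symm fun hle => hne (h'.1.2 _ h.1.1 hle)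
    exact lt_asymm h1 h2
  subst hα
  exact ⟨add_right_cancel hadd, rfl⟩

end Monomials

/-! ### Marked sets with coefficients in a ring -/

section MarkedSets

variable {K : Type u} [Field K] {n : ℕ} {J : Ideal (MvPolynomial (Fin (n + 1)) K)}
  {A : Type*} [CommRing A] {B : Type*} [CommRing B]

open Classical in
/-- The coefficient of `x^γ` in the tail with head `x^α` of the marked set with coefficients `c`. -/
def tailCoeff (c : Param J → A) (α γ : Mon n) : A :=
  if h : α ∈ basisMons J ∧ γ ∉ mons J ∧ γ.degree = α.degree then c ⟨(α, γ), h⟩ else 0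

/-- The tail with head `x^α` of the marked set with coefficients `c`. -/
def markedTail (c : Param J → A) (α : Mon n) : MvPolynomial (Fin (n + 1)) A :=
  ∑ γ ∈ Finset.finsuppAntidiag Finset.univ α.degree, MvPolynomial.monomial γ (tailCoeff c α γ)

/-- The polynomial with head `x^α` of the marked set with coefficients `c`. -/
def markedPoly (c : Param J → A) (α : Mon n) : MvPolynomial (Fin (n + 1)) A :=
  MvPolynomial.monomial α 1 - markedTail c α

theorem tailCoeff_param (c : Param J → A) (p : Param J) : tailCoeff c p.1.1 p.1.2 = c p := by
  rw [tailCoeff, dif_pos p.2]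
  rfl

theorem tailCoeff_of_mem (c : Param J → A) (α : Mon n) {γ : Mon n} (hγ : γ ∈ mons J) :
    tailCoeff c α γ = 0 :=
  dif_neg fun h => h.2.1 hγ

theorem tailCoeff_of_degree_ne (c : Param J → A) {α γ : Mon n} (h : γ.degree ≠ α.degree) :
    tailCoeff c α γ = 0 :=
  dif_neg fun h' => h h'.2.2

theorem tailCoeff_comp (f : A →+* B) (c : Param J → A) (α γ : Mon n) :
    tailCoeff (fun p => f (c p)) α γ = f (tailCoeff c α γ) := by
  unfold tailCoeff
  split_ifs <;> simp

theorem coeff_markedTail (c : Param J → A) (α γ : Mon n) :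
    (markedTail c α).coeff γ = tailCoeff c α γ := by
  classical
  simp only [markedTail, MvPolynomial.coeff_sum, MvPolynomial.coeff_monomial]
  rw [Finset.sum_ite_eq' , ite_eq_left_iff]
  intro h
  rw [tailCoeff_of_degree_ne]
  contrapose! h
  simp [Finset.mem_finsuppAntidiag, ← h, Finsupp.degree_eq_sum]

theorem map_markedPoly (f : A →+* B) (c : Param J → A) (α : Mon n) :
    MvPolynomial.map f (markedPoly c α) = markedPoly (fun p => f (c p)) α := by
  simp [markedPoly, markedTail, tailCoeff_comp]

theorem genericPoly_eq (α : Mon n) :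
    genericPoly J α = markedPoly (J := J) (MvPolynomial.X (R := K)) α := by
  unfold genericPoly markedPoly markedTail tailCoeff
  congr 1
  refine Finset.sum_congr rfl fun γ _ => ?_
  split_ifs
  · rfl
  · exact (MvPolynomial.monomial_zero).symm

theorem isHomogeneous_markedTail (c : Param J → A) (α : Mon n) :
    (markedTail c α).IsHomogeneous α.degree := by
  intro γ hγ
  rw [coeff_markedTail] at hγ
  change Finsupp.weight (fun _ => 1) γ = _
  rw [← Finsupp.degree_eq_weight_one]
  by_contra h
  exact hγ (tailCoeff_of_degree_ne c h)

theorem isHomogeneous_markedPoly (c : Param J → A) (α : Mon n) :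
    (markedPoly c α).IsHomogeneous α.degree :=
  (MvPolynomial.isHomogeneous_monomial _ rfl).sub (isHomogeneous_markedTail c α)

variable (J A) in
/-- The polynomials all of whose monomials are outside `J`. -/
def normalForms : Submodule A (MvPolynomial (Fin (n + 1)) A) where
  carrier := {h | ∀ γ ∈ mons J, h.coeff γ = 0}
  add_mem' ha hb γ hγ := by simp [ha γ hγ, hb γ hγ]
  zero_mem' γ _ := by simp
  smul_mem' c h hh γ hγ := by simp [hh γ hγ]

theorem monomial_eq_smul {σ : Type*} (μ : σ →₀ ℕ) (a : A) :
    MvPolynomial.monomial μ a = a • MvPolynomial.monomial μ (1 : A) := by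
  rw [MvPolynomial.smul_monomial, smul_eq_mul, mul_one]

theorem monomial_mem_normalForms {γ : Mon n} (hγ : γ ∉ mons J) (a : A) :
    MvPolynomial.monomial γ a ∈ normalForms J A := by
  classical
  intro μ hμ
  rw [MvPolynomial.coeff_monomial, if_neg]
  rintro rfl
  exact hγ hμ

/-- The ideal generated by the marked set with coefficients `c`. -/
def markedSpan (c : Param J → A) : Ideal (MvPolynomial (Fin (n + 1)) A) :=
  Ideal.span (markedPoly c '' basisMons J)

theorem markedPoly_mem_markedSpan (c : Param J → A) {α : Mon n} (hα : α ∈ basisMons J) :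
    markedPoly c α ∈ markedSpan c :=
  Ideal.subset_span ⟨α, hα, rfl⟩

/-- The marked set with coefficients `c` is a marked basis. -/
def IsMarkedBasis (c : Param J → A) : Prop :=
  ∀ h ∈ markedSpan c, h ∈ normalForms J A → h = 0

/-- The span of the products `x^δ F_α`, where `x^δ x^α` is a star decomposition and `δ ∈ s`. -/
def starSpan (c : Param J → A) (s : Set (Mon n)) : Submodule A (MvPolynomial (Fin (n + 1)) A) :=
  Submodule.span A {p | ∃ δ α, IsStar J δ α ∧ δ ∈ s ∧
    p = MvPolynomial.monomial δ 1 * markedPoly c α}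

theorem starSpan_mono (c : Param J → A) {s t : Set (Mon n)} (h : s ⊆ t) :
    starSpan c s ≤ starSpan c t :=
  Submodule.span_mono fun _ ⟨δ, α, h1, h2, h3⟩ => ⟨δ, α, h1, h h2, h3⟩

theorem mem_starSpan (c : Param J → A) {s : Set (Mon n)} {δ α : Mon n} (h : IsStar J δ α)
    (hδ : δ ∈ s) : MvPolynomial.monomial δ 1 * markedPoly c α ∈ starSpan c s :=
  Submodule.subset_span ⟨δ, α, h, hδ, rfl⟩

theorem starSpan_le_markedSpan (c : Param J → A) (s : Set (Mon n)) :
    starSpan c s ≤ (markedSpan c).restrictScalars A := by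
  refine Submodule.span_le.2 ?_
  rintro _ ⟨δ, α, h, -, rfl⟩
  exact (markedSpan c).mul_mem_left _ (markedPoly_mem_markedSpan c h.1)

theorem monomial_mul_markedTail (c : Param J → A) (δ α : Mon n) :
    MvPolynomial.monomial δ 1 * markedTail c α =
      ∑ γ ∈ Finset.finsuppAntidiag Finset.univ α.degree,
        tailCoeff c α γ • MvPolynomial.monomial (δ + γ) (1 : A) := by
  simp [markedTail, Finset.mul_sum, MvPolynomial.monomial_mul, MvPolynomial.smul_monomial]

/-- Replace the head in `x^δ x^α` by its tail: the new monomials have star cofactors below `δ`, and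
induction applies. The bound `D` on the cofactors used is what later keeps the S-polynomial argument
well-founded. -/
theorem monomial_mem_normalForms_sup_starSpan (hS : StableMons J) (c : Param J → A)
    (D : Colex (Mon n)) (μ : Mon n)
    (hD : ∀ δ α, IsStar J δ α → δ + α = μ → toColex δ < D) :
    MvPolynomial.monomial μ (1 : A) ∈
      normalForms J A ⊓ MvPolynomial.homogeneousSubmodule (Fin (n + 1)) A μ.degree ⊔
        starSpan c {δ | toColex δ < D} := by
  induction D using WellFoundedLT.induction generalizing μ with
  | ind D ih =>
    by_cases hμ : μ ∈ mons J
    · obtain ⟨δ, α, hs, rfl⟩ := exists_isStar hS μ hμ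
      have hδ := hD δ α hs rfl
      have : MvPolynomial.monomial (δ + α) (1 : A) =
          MvPolynomial.monomial δ 1 * markedPoly c α +
            MvPolynomial.monomial δ 1 * markedTail c α := by
        rw [← mul_add, markedPoly, sub_add_cancel, MvPolynomial.monomial_mul, one_mul]
      rw [this]
      refine add_mem (Submodule.mem_sup_right (mem_starSpan c hs hδ)) ?_
      rw [monomial_mul_markedTail]
      refine sum_mem fun γ _ => ?_
      by_cases hγ : γ ∉ mons J ∧ γ.degree = α.degree
      · refine Submodule.smul_mem _ _ ?_
        have h1 := ih (toColex δ) hδ (δ + γ) fun δ' α' hs' hadd =>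
          hs'.toColex_lt hadd.symm fun hle => hγ.1 (mons_of_le hs'.1.1 hle)
        have hdeg : (δ + γ).degree = (δ + α).degree := by
          rw [map_add, map_add, hγ.2]
        rw [hdeg] at h1
        exact sup_le_sup_left (starSpan_mono c fun ε (hε : toColex ε < toColex δ) =>
          hε.trans hδ) _ h1
      · rw [tailCoeff, dif_neg fun h => hγ h.2, zero_smul]
        exact zero_mem _
    · exact Submodule.mem_sup_left ⟨monomial_mem_normalForms hμ 1,
        MvPolynomial.isHomogeneous_monomial _ rfl⟩

theorem mem_normalForms_sup_starSpan (hS : StableMons J) (c : Param J → A)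
    (D : Colex (Mon n)) (h : MvPolynomial (Fin (n + 1)) A)
    (hD : ∀ δ α, IsStar J δ α → h.coeff (δ + α) ≠ 0 → toColex δ < D) :
    h ∈ normalForms J A ⊔ starSpan c {δ | toColex δ < D} := by
  rw [h.as_sum]
  refine sum_mem fun μ hμ => ?_
  rw [monomial_eq_smul]
  refine Submodule.smul_mem _ _ ((sup_le_sup inf_le_left le_rfl :
    normalForms J A ⊓ MvPolynomial.homogeneousSubmodule (Fin (n + 1)) A μ.degree ⊔ _ ≤ _)
    (monomial_mem_normalForms_sup_starSpan hS c D μ ?_))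
  rintro δ α hs rfl
  exact hD δ α hs (MvPolynomial.mem_support_iff.1 hμ)

theorem exists_toColex_lt (μ : Mon n) :
    ∃ D : Colex (Mon n), ∀ δ α, IsStar J δ α → δ + α = μ → toColex δ < D := by
  -- Every cofactor divides `x^μ`, so `x_0 x^μ` is a strict upper bound.
  refine ⟨toColex (μ + Finsupp.single 0 1), ?_⟩
  rintro δ α - rfl
  refine (Finsupp.toColex_monotone (le_self_add : δ ≤ δ + α)).trans_lt ?_
  refine lt_of_le_of_ne (Finsupp.toColex_monotone le_self_add) fun h => ?_
  simpa using toColex.injective h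

/-- Every monomial has a normal form modulo a marked set. -/
theorem exists_normalForm (hS : StableMons J) (c : Param J → A) (μ : Mon n) :
    ∃ H ∈ normalForms J A, H.IsHomogeneous μ.degree ∧
      MvPolynomial.monomial μ 1 - H ∈ markedSpan c := by
  obtain ⟨D, hD⟩ := exists_toColex_lt (J := J) μ
  obtain ⟨H, hH, g, hg, hadd⟩ := Submodule.mem_sup.1
    (monomial_mem_normalForms_sup_starSpan hS c D μ hD)
  exact ⟨H, hH.1, hH.2, by
    rw [← hadd, add_sub_cancel_left]
    exact starSpan_le_markedSpan c _ hg⟩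

theorem coeff_monomial_mul_markedPoly (c : Param J → A) {δ α δ' α' : Mon n}
    (h : IsStar J δ α) (h' : IsStar J δ' α')
    (hne : (MvPolynomial.monomial δ' 1 * markedPoly c α').coeff (δ + α) ≠ 0) :
    (δ' = δ ∧ α' = α) ∨ toColex δ < toColex δ' := by
  classical
  by_contra! hcon
  apply hne
  rw [MvPolynomial.coeff_monomial_mul', one_mul]
  split_ifs with hle
  · rw [markedPoly, MvPolynomial.coeff_sub, coeff_markedTail, MvPolynomial.coeff_monomial,
      if_neg, zero_sub, neg_eq_zero, tailCoeff, dif_neg]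
    · rintro ⟨-, hγ, -⟩
      refine absurd (h.toColex_lt (add_tsub_cancel_of_le hle) ?_) (not_lt.2 hcon.2)
      exact fun hα => hγ (mons_of_le h.1.1 hα)
    · intro h1
      have := h'.unique h (by rw [h1, add_tsub_cancel_of_le hle])
      exact hcon.1 this.1 this.2
  · rfl

/-- Triangularity: at the head of the product with the largest cofactor no other product
contributes, so its coefficient survives at a monomial of `J`. -/
theorem starSpan_disjoint (c : Param J → A) {h : MvPolynomial (Fin (n + 1)) A}
    (hs : h ∈ starSpan c Set.univ) (hN : h ∈ normalForms J A) : h = 0 := by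
  classical
  have hset : {p | ∃ δ α, IsStar J δ α ∧ δ ∈ Set.univ ∧
      p = MvPolynomial.monomial δ 1 * markedPoly c α} =
      Set.range fun q : {q : Mon n × Mon n // IsStar J q.1 q.2} =>
        MvPolynomial.monomial q.1.1 1 * markedPoly c q.1.2 := by
    ext p
    constructor
    · rintro ⟨δ, α, h1, -, rfl⟩
      exact ⟨⟨(δ, α), h1⟩, rfl⟩
    · rintro ⟨q, rfl⟩
      exact ⟨_, _, q.2, trivial, rfl⟩
  rw [starSpan, hset, Finsupp.mem_span_range_iff_exists_finsupp] at hs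
  obtain ⟨a, rfl⟩ := hs
  by_cases ha : a.support.Nonempty
  · obtain ⟨p, hp, hmax⟩ := Finset.exists_max_image a.support (fun q => toColex q.1.1) ha
    exfalso
    have h0 := hN _ p.2.mem
    rw [Finsupp.sum, MvPolynomial.coeff_sum, Finset.sum_eq_single p] at h0
    · refine Finsupp.mem_support_iff.1 hp ?_
      rw [MvPolynomial.coeff_smul, MvPolynomial.coeff_monomial_mul, markedPoly,
        MvPolynomial.coeff_sub, coeff_markedTail, tailCoeff_of_mem c _ p.2.1.1] at h0
      simpa using h0
    · intro q hq hqp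
      rw [MvPolynomial.coeff_smul]
      by_contra hne
      rcases coeff_monomial_mul_markedPoly c p.2 q.2 (right_ne_zero_of_smul hne) with h1 | h1
      · exact hqp (Subtype.ext (Prod.ext h1.1 h1.2))
      · exact absurd h1 (not_lt.2 (hmax q hq))
    · exact fun hp' => absurd hp hp'
  · rw [Finset.not_nonempty_iff_eq_empty, Finsupp.support_eq_empty] at ha
    simp [ha]

end MarkedSets

/-! ### The ideal of the marked scheme and marked bases -/

section Criterion

variable {K : Type u} [Field K] {n : ℕ} {J : Ideal (MvPolynomial (Fin (n + 1)) K)}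
  {A : Type*} [CommRing A] {B : Type*} [CommRing B]

theorem map_mem_starSpan (f : A →+* B) (c : Param J → A) (s : Set (Mon n))
    {h : MvPolynomial (Fin (n + 1)) A} (hh : h ∈ starSpan c s) :
    MvPolynomial.map f h ∈ starSpan (fun p => f (c p)) s := by
  induction hh using Submodule.span_induction with
  | mem x hx =>
    obtain ⟨δ, α, h1, h2, rfl⟩ := hx
    rw [map_mul, map_markedPoly, MvPolynomial.map_monomial, map_one]
    exact mem_starSpan _ h1 h2
  | zero => simp
  | add x y _ _ hx hy => rw [map_add]; exact add_mem hx hy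
  | smul a x _ hx =>
    rw [MvPolynomial.smul_eq_C_mul, map_mul, MvPolynomial.map_C, ← MvPolynomial.smul_eq_C_mul]
    exact Submodule.smul_mem _ _ hx

theorem toColex_lt_of_coeff_mul_markedTail (c : Param J → A) {ε α η β : Mon n}
    (hs : IsStar J η β)
    (h : (MvPolynomial.monomial ε 1 * markedTail c α).coeff (η + β) ≠ 0) :
    toColex η < toColex ε := by
  classical
  rw [MvPolynomial.coeff_monomial_mul', one_mul] at h
  split_ifs at h with hle
  · rw [coeff_markedTail] at h
    refine hs.toColex_lt (add_tsub_cancel_of_le hle) fun hβ => h ?_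
    exact tailCoeff_of_mem c α (mons_of_le hs.1.1 hβ)
  · exact absurd rfl h

theorem ReductionStep.sub_mem {h h' : MvPolynomial (Fin (n + 1)) (MvPolynomial (Param J) K)}
    (hr : ReductionStep J h h') :
    h - h' ∈ starSpan (J := J) (MvPolynomial.X (R := K)) Set.univ := by
  obtain ⟨α, hα, δ, hs, -, rfl⟩ := hr
  rw [sub_sub_cancel, genericPoly_eq, monomial_eq_smul, smul_mul_assoc]
  exact Submodule.smul_mem _ _ (mem_starSpan _ ⟨hα, hs⟩ trivial)

theorem sub_mem_of_reduction {h h' : MvPolynomial (Fin (n + 1)) (MvPolynomial (Param J) K)}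
    (hr : Relation.ReflTransGen (ReductionStep J) h h') :
    h - h' ∈ starSpan (J := J) (MvPolynomial.X (R := K)) Set.univ := by
  induction hr with
  | refl => simp
  | tail _ hb ih =>
    rw [← sub_add_sub_cancel]
    exact add_mem ih hb.sub_mem

theorem isDershowitzMannaLT_map {ι α : Type*} [DecidableEq ι] [Preorder α] (d : ι → α)
    {P Q : Finset ι} {a : ι} (ha : a ∈ P \ Q) (h : ∀ b ∈ Q \ P, d b < d a) :
    Multiset.IsDershowitzMannaLT (Q.val.map d) (P.val.map d) := by
  have key : ∀ P Q : Finset ι, P.val = (P ∩ Q).val + (P \ Q).val := fun P Q => by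
    rw [← Finset.disjUnion_val (P ∩ Q) (P \ Q) (by
      rw [Finset.disjoint_left]; intro x; simp +contextual)]
    congr 1
    ext x
    simp only [Finset.mem_disjUnion, Finset.mem_inter, Finset.mem_sdiff]
    tauto
  refine ⟨(P ∩ Q).val.map d, (Q \ P).val.map d, (P \ Q).val.map d, ?_, ?_, ?_, ?_⟩
  · intro h0
    rw [← Finset.mem_val, Multiset.map_eq_zero.1 h0] at ha
    simp at ha
  · rw [← Multiset.map_add, Finset.inter_comm, ← key]
  · rw [← Multiset.map_add, ← key]
  · intro y hy
    obtain ⟨b, hb, rfl⟩ := Multiset.mem_map.1 hy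
    exact ⟨d a, Multiset.mem_map.2 ⟨a, ha, rfl⟩, h b hb⟩

/-- One step trades a monomial of `J` for monomials of `J` with smaller cofactors, so the multiset
of cofactors drops in the Dershowitz–Manna order. Termination is needed for actual reduction
sequences because `markedIdeal` is defined through them. -/
theorem exists_reduction (hS : StableMons J)
    (h : MvPolynomial (Fin (n + 1)) (MvPolynomial (Param J) K)) :
    ∃ H, Relation.ReflTransGen (ReductionStep J) h H ∧ IsReducedPoly J H := by
  classical
  choose! d a hd using exists_isStar hS
  let rk : MvPolynomial (Fin (n + 1)) (MvPolynomial (Param J) K) → Multiset (Colex (Mon n)) :=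
    fun h => (h.support.filter (· ∈ mons J)).val.map fun μ => toColex (d μ)
  induction h using (InvImage.wf rk
    (Multiset.wellFounded_isDershowitzMannaLT (α := Colex (Mon n)))).induction with
  | h h ih =>
  by_cases hred : IsReducedPoly J h
  · exact ⟨h, .refl, hred⟩
  unfold IsReducedPoly at hred
  push Not at hred
  obtain ⟨μ, hμ, hμJ⟩ := hred
  obtain ⟨hs, hadd⟩ := hd μ hμJ
  set h' := h - MvPolynomial.monomial (d μ) (h.coeff (d μ + a μ)) * genericPoly J (a μ) with hh'
  have hstep : ReductionStep J h h' :=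
    ⟨a μ, hs.1, d μ, hs.2, by rw [hadd]; exact MvPolynomial.mem_support_iff.1 hμ, rfl⟩
  have heq : h' = h - MvPolynomial.monomial μ (h.coeff μ) + h.coeff μ •
      (MvPolynomial.monomial (d μ) 1 * markedTail (J := J) (MvPolynomial.X (R := K)) (a μ)) := by
    rw [hh', hadd, genericPoly_eq, markedPoly, mul_sub, MvPolynomial.monomial_mul, hadd, mul_one,
      ← smul_mul_assoc, MvPolynomial.smul_monomial, smul_eq_mul, mul_one]
    ring
  have hcoef : ∀ ν ∈ mons J, h'.coeff ν ≠ 0 → h.coeff ν = 0 → toColex (d ν) < toColex (d μ) := by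
    intro ν hν h1 h2
    obtain ⟨hsν, hνadd⟩ := hd ν hν
    have hne : μ ≠ ν := by
      rintro rfl
      exact MvPolynomial.mem_support_iff.1 hμ h2
    rw [heq, MvPolynomial.coeff_add, MvPolynomial.coeff_sub, h2, MvPolynomial.coeff_monomial,
      if_neg hne, sub_zero, zero_add, MvPolynomial.coeff_smul] at h1
    refine toColex_lt_of_coeff_mul_markedTail (MvPolynomial.X (R := K)) (α := a μ) hsν ?_
    rw [hνadd]
    exact right_ne_zero_of_smul h1
  have hμ' : h'.coeff μ = 0 := by
    rw [heq, MvPolynomial.coeff_add, MvPolynomial.coeff_sub, MvPolynomial.coeff_monomial,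
      if_pos rfl, sub_self, zero_add, MvPolynomial.coeff_smul]
    by_contra hne
    have := right_ne_zero_of_smul hne
    exact lt_irrefl (toColex (d μ)) (toColex_lt_of_coeff_mul_markedTail (MvPolynomial.X (R := K))
      (α := a μ) hs (by rw [hadd]; exact this))
  obtain ⟨H, hH, hHr⟩ := ih h' (isDershowitzMannaLT_map (fun μ => toColex (d μ)) (a := μ)
    (by simp [hμ', MvPolynomial.mem_support_iff.1 hμ, hμJ]) fun ν hν => by
      simp only [Finset.mem_sdiff, Finset.mem_filter, MvPolynomial.mem_support_iff] at hν
      exact hcoef ν hν.1.2 hν.1.1 (by tauto))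
  exact ⟨H, .head hstep hH, hHr⟩

/-- The S-polynomials of a marked set. -/
def markedSPoly (c : Param J → A) (α β : Mon n) : MvPolynomial (Fin (n + 1)) A :=
  MvPolynomial.monomial (α ⊔ β - α) 1 * markedPoly c α -
    MvPolynomial.monomial (α ⊔ β - β) 1 * markedPoly c β

theorem map_sPoly (f : MvPolynomial (Param J) K →+* A) (α β : Mon n) :
    MvPolynomial.map f (sPoly J α β) = markedSPoly (fun p => f (MvPolynomial.X p)) α β := by
  simp [sPoly, markedSPoly, genericPoly_eq, map_markedPoly]

theorem markedSPoly_mem_markedSpan (c : Param J → A) {α β : Mon n} (hα : α ∈ basisMons J)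
    (hβ : β ∈ basisMons J) : markedSPoly c α β ∈ markedSpan c :=
  sub_mem (Ideal.mul_mem_left _ _ (markedPoly_mem_markedSpan c hα))
    (Ideal.mul_mem_left _ _ (markedPoly_mem_markedSpan c hβ))

/-- Induction on the cofactor. If some `x_i ∣ x^ε` exceeds `min x^α`, then `x_i x^α` has a star
decomposition `x^δ x^β` with `δ` below `x_i`, and `x_i F_α - x^δ F_β` is an S-polynomial. It is
spanned by products with cofactors below `x_i`; multiplication by `x^ε / x_i` keeps them below
`x^ε`. -/
theorem monomial_mul_markedPoly_mem (hS : StableMons J) (c : Param J → A)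
    (hc : ∀ α ∈ basisMons J, ∀ β ∈ basisMons J, markedSPoly c α β ∈ starSpan c Set.univ)
    (ε : Colex (Mon n)) (α : Mon n) (hα : α ∈ basisMons J) :
    MvPolynomial.monomial (ofColex ε) 1 * markedPoly c α ∈ starSpan c Set.univ := by
  induction ε using WellFoundedLT.induction generalizing α with
  | ind ε ih =>
  by_cases hst : IsStar J (ofColex ε) α
  · exact mem_starSpan c hst trivial
  unfold IsStar at hst
  push Not at hst
  obtain ⟨i, hi, j, hj, hji⟩ := hst hα
  set e : Mon n := Finsupp.single i 1
  obtain ⟨ε', hε'⟩ : ∃ ε', ofColex ε = ε' + e := by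
    refine ⟨ofColex ε - e, (tsub_add_cancel_of_le (Finsupp.single_le_iff.2 ?_)).symm⟩
    exact Nat.one_le_iff_ne_zero.2 (Finsupp.mem_support_iff.1 hi)
  obtain ⟨δ, β, hs, hadd⟩ := exists_isStar hS (e + α) (mons_add hα.1 e)
  have hβα : ¬ β ≤ α := by
    intro hle
    obtain rfl := hα.2 β hs.1.1 hle
    obtain rfl : δ = e := add_right_cancel hadd
    exact absurd (hs.2 i (by simp [e]) j hj) (not_le.2 hji)
  have hδ : toColex δ < toColex e := hs.toColex_lt hadd.symm hβα
  have hβle : β ≤ e + α := le_add_self.trans_eq hadd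
  -- Since `x^β` divides `x_i x^α` but not `x^α`, no larger multiple is needed.
  have hlcm : α ⊔ β = e + α := by
    obtain ⟨k, hk⟩ : ∃ k, α k < β k := by
      by_contra! hcon
      exact hβα hcon
    have hki : k = i := by
      by_contra hne
      have := hβle k
      simp [e, Ne.symm hne] at this
      omega
    subst hki
    ext l
    have h1 := hβle l
    by_cases hl : k = l
    · subst hl
      simp [e] at h1 ⊢
      omega
    · simp [e, hl] at h1 ⊢
      omega
  have hSp : markedSPoly c α β = MvPolynomial.monomial e 1 * markedPoly c α -
      MvPolynomial.monomial δ 1 * markedPoly c β := by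
    rw [markedSPoly, hlcm, add_tsub_cancel_right, ← hadd, add_tsub_cancel_right]
  have hSt : markedSPoly c α β = MvPolynomial.monomial δ 1 * markedTail c β -
      MvPolynomial.monomial e 1 * markedTail c α := by
    rw [hSp, markedPoly, markedPoly, mul_sub, mul_sub, MvPolynomial.monomial_mul,
      MvPolynomial.monomial_mul, hadd]
    ring
  -- The hypothesis gives membership only in the full span. Reducing with cofactors below `x_i`
  -- leaves a normal form in that span, which is zero by `starSpan_disjoint`.
  have hmem : markedSPoly c α β ∈ starSpan c {η | toColex η < toColex e} := by
    have h1 := mem_normalForms_sup_starSpan hS c (toColex e) (markedSPoly c α β) (by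
      intro η κ hs' hne
      rw [hSt, MvPolynomial.coeff_sub] at hne
      by_contra hlt
      apply hne
      rw [sub_eq_zero]
      trans (0 : A)
      · by_contra h0
        exact hlt ((toColex_lt_of_coeff_mul_markedTail c hs' h0).trans hδ)
      · by_contra h0
        exact hlt (toColex_lt_of_coeff_mul_markedTail c hs' (Ne.symm h0)))
    obtain ⟨N, hN, g, hg, hadd'⟩ := Submodule.mem_sup.1 h1
    have hN0 : N = 0 := by
      refine starSpan_disjoint c ?_ hN
      rw [eq_sub_of_add_eq hadd']
      exact sub_mem (hc α hα β hs.1) (starSpan_mono c (Set.subset_univ _) hg)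
    rwa [← hadd', hN0, zero_add]
  have hmul : ∀ g ∈ starSpan c {η | toColex η < toColex e},
      MvPolynomial.monomial ε' 1 * g ∈ starSpan c Set.univ := by
    intro g hg
    induction hg using Submodule.span_induction with
    | mem x hx =>
      obtain ⟨η, κ, h1, h2, rfl⟩ := hx
      rw [← mul_assoc, MvPolynomial.monomial_mul, one_mul]
      refine ih (toColex (ε' + η)) ?_ κ h1.1
      have h3 : toColex η < toColex e := h2
      have h4 : toColex ε' + toColex η < toColex ε' + toColex e := add_lt_add_right h3 _
      have h5 : ε = toColex ε' + toColex e := ofColex.injective hε'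
      rw [h5]
      exact h4
    | zero => simp
    | add x y _ _ hx hy => rw [mul_add]; exact add_mem hx hy
    | smul a x _ hx => rw [mul_smul_comm]; exact Submodule.smul_mem _ _ hx
  have hfin : MvPolynomial.monomial (ofColex ε) 1 * markedPoly c α =
      MvPolynomial.monomial ε' 1 * markedSPoly c α β +
        MvPolynomial.monomial (ε' + δ) 1 * markedPoly c β := by
    have hm : ∀ a b : Mon n, MvPolynomial.monomial (a + b) (1 : A) =
        MvPolynomial.monomial a 1 * MvPolynomial.monomial b 1 := fun a b => by
      rw [MvPolynomial.monomial_mul, one_mul]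
    rw [hSp, hε', hm, hm]
    ring
  rw [hfin]
  refine add_mem (hmul _ hmem) (ih (toColex (ε' + δ)) ?_ β hs.1)
  have h4 : toColex ε' + toColex δ < toColex ε' + toColex e := add_lt_add_right hδ _
  have h5 : ε = toColex ε' + toColex e := ofColex.injective hε'
  rw [h5]
  exact h4

theorem markedSpan_le_starSpan (hS : StableMons J) (c : Param J → A)
    (hc : ∀ α ∈ basisMons J, ∀ β ∈ basisMons J, markedSPoly c α β ∈ starSpan c Set.univ)
    {h : MvPolynomial (Fin (n + 1)) A} (hh : h ∈ markedSpan c) : h ∈ starSpan c Set.univ := by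
  have hmon : ∀ (ε : Mon n), ∀ g ∈ starSpan c Set.univ,
      MvPolynomial.monomial ε 1 * g ∈ starSpan c Set.univ := by
    intro ε g hg
    induction hg using Submodule.span_induction with
    | mem x hx =>
      obtain ⟨η, κ, h1, -, rfl⟩ := hx
      rw [← mul_assoc, MvPolynomial.monomial_mul, one_mul]
      exact monomial_mul_markedPoly_mem hS c hc (toColex (ε + η)) κ h1.1
    | zero => simp
    | add x y _ _ hx hy => rw [mul_add]; exact add_mem hx hy
    | smul a x _ hx => rw [mul_smul_comm]; exact Submodule.smul_mem _ _ hx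
  have hmul : ∀ p, ∀ g ∈ starSpan c Set.univ, p * g ∈ starSpan c Set.univ := by
    intro p g hg
    rw [p.as_sum, Finset.sum_mul]
    refine sum_mem fun μ _ => ?_
    rw [monomial_eq_smul, smul_mul_assoc]
    exact Submodule.smul_mem _ _ (hmon μ g hg)
  induction hh using Submodule.span_induction with
  | mem x hx =>
    obtain ⟨α, hα, rfl⟩ := hx
    have := monomial_mul_markedPoly_mem hS c hc (toColex 0) α hα
    simpa using this
  | zero => simp
  | add x y _ _ hx hy => exact add_mem hx hy
  | smul a x _ hx => exact hmul a x hx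

/-- A homomorphism kills the ideal of the marked scheme if and only if its coefficients define a
marked basis. -/
theorem markedIdeal_le_ker_iff (hS : StableMons J) (f : MvPolynomial (Param J) K →+* A) :
    markedIdeal J ≤ RingHom.ker f ↔ IsMarkedBasis (J := J) fun p => f (MvPolynomial.X p) := by
  constructor
  · intro hf h hh hN
    refine starSpan_disjoint (J := J) (fun p => f (MvPolynomial.X p)) ?_ hN
    refine markedSpan_le_starSpan hS _ (fun α hα β hβ => ?_) hh
    obtain ⟨H, hH, hred⟩ := exists_reduction hS (sPoly J α β)
    have h1 := map_mem_starSpan f _ _ (sub_mem_of_reduction hH)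
    have h2 : MvPolynomial.map f H = 0 := by
      ext γ
      rw [MvPolynomial.coeff_map, MvPolynomial.coeff_zero]
      exact hf (Ideal.subset_span ⟨α, hα, β, hβ, H, hH, hred, γ, rfl⟩)
    rwa [map_sub, h2, sub_zero, map_sPoly] at h1
  · intro hc
    refine Ideal.span_le.2 ?_
    rintro _ ⟨α, hα, β, hβ, H, hH, hred, γ, rfl⟩
    have h1 := starSpan_le_markedSpan _ _ (map_mem_starSpan f _ _ (sub_mem_of_reduction hH))
    rw [map_sub, map_sPoly] at h1
    have h2 : MvPolynomial.map f H ∈ markedSpan (J := J) fun p => f (MvPolynomial.X p) := by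
      have := sub_mem (markedSPoly_mem_markedSpan (J := J) (fun p => f (MvPolynomial.X p)) hα hβ)
        h1
      rwa [sub_sub_cancel] at this
    have h3 := hc _ h2 fun γ hγ => by
      rw [MvPolynomial.coeff_map]
      by_cases h0 : H.coeff γ = 0
      · rw [h0, map_zero]
      · exact absurd hγ (hred γ (MvPolynomial.mem_support_iff.2 h0))
    have h4 := congrArg (MvPolynomial.coeff γ) h3
    rwa [MvPolynomial.coeff_map] at h4

end Criterion

/-! ### Truncations of saturated strongly stable ideals -/

section Truncation

variable {K : Type u} [Field K] {n : ℕ} {J : Ideal (MvPolynomial (Fin (n + 1)) K)}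
  {A : Type*} [CommRing A]

theorem le_degree_of_mem_span {m : ℤ} {s : Set (MvPolynomial (Fin (n + 1)) A)}
    (hs : ∀ f ∈ s, ∀ γ : Mon n, f.coeff γ ≠ 0 → m ≤ γ.degree)
    {f : MvPolynomial (Fin (n + 1)) A} (hf : f ∈ Ideal.span s) (γ : Mon n) (hγ : f.coeff γ ≠ 0) :
    m ≤ γ.degree := by
  classical
  induction hf using Submodule.span_induction generalizing γ with
  | mem x hx => exact hs x hx γ hγ
  | zero => simp at hγ
  | add x y _ _ hx hy =>
    by_cases h : x.coeff γ = 0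
    · exact hy γ (by simpa [h] using hγ)
    · exact hx γ h
  | smul a x _ hx =>
    rw [smul_eq_mul] at hγ
    obtain ⟨γ₁, -, γ₂, h2, rfl⟩ := Finset.mem_add.1
      (MvPolynomial.support_mul a x (MvPolynomial.mem_support_iff.2 hγ))
    refine (hx γ₂ (MvPolynomial.mem_support_iff.1 h2)).trans ?_
    rw [map_add]
    push_cast
    omega

theorem mem_mons_truncation {m : ℤ} {α : Mon n} :
    α ∈ mons (truncation J m) ↔ α ∈ mons J ∧ m ≤ (α.degree : ℤ) := by
  constructor
  · intro h
    refine ⟨Ideal.span_le.2 (fun f hf => hf.1) h, ?_⟩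
    refine le_degree_of_mem_span (A := K) ?_ h α (by simp)
    rintro f ⟨-, d, hd, hf⟩ γ hγ
    have := hf hγ
    change Finsupp.weight (fun _ => 1) γ = _ at this
    rw [← Finsupp.degree_eq_weight_one] at this
    exact hd.trans_eq (by exact_mod_cast this.symm)
  · rintro ⟨h, hm⟩
    exact Ideal.subset_span ⟨h, α.degree, hm, MvPolynomial.isHomogeneous_monomial _ rfl⟩

theorem IncreasingMove.degree_eq {α β : Mon n} (h : IncreasingMove α β) :
    β.degree = α.degree := by
  obtain ⟨i, j, -, h⟩ := h
  have := congrArg Finsupp.degree h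
  simp only [map_add, Finsupp.degree_single] at this
  omega

theorem StableMons.truncation (h : StableMons J) (m : ℤ) : StableMons (truncation J m) := by
  intro α β hm hα
  rw [mem_mons_truncation] at hα ⊢
  exact ⟨h α β hm hα.1, by rw [hm.degree_eq]; exact hα.2⟩

/-- Division by `x_0` preserves the monomials of `J`. -/
def SaturatedMons (J : Ideal (MvPolynomial (Fin (n + 1)) K)) : Prop :=
  ∀ α : Mon n, α + Finsupp.single 0 1 ∈ mons J → α ∈ mons J

/-- The exponent `r = 1` works for every variable: from `x_0 x^α ∈ J`, increasing moves give `x_j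
x^α ∈ J`. -/
theorem IsSaturated.saturatedMons (h : IsSaturated J) (hS : StableMons J) : SaturatedMons J := by
  intro α hα
  refine h _ fun j => ⟨1, ?_⟩
  rw [pow_one, MvPolynomial.X, MvPolynomial.monomial_mul, one_mul,
    add_comm (Finsupp.single j 1)]
  change α + Finsupp.single j 1 ∈ mons J
  by_cases hj : j = 0
  · rwa [hj]
  · refine hS _ _ ⟨0, j, Fin.pos_iff_ne_zero.2 hj, add_right_comm _ _ _⟩ hα

theorem SaturatedMons.of_add_single (hJ : SaturatedMons J) {α : Mon n} {k : ℕ}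
    (h : α + Finsupp.single 0 k ∈ mons J) : α ∈ mons J := by
  induction k with
  | zero => simpa using h
  | succ k ih =>
    refine ih (hJ _ ?_)
    rwa [add_assoc, ← Finsupp.single_add]

theorem SaturatedMons.erase_mem (hJ : SaturatedMons J) {α : Mon n} (h : α ∈ mons J) :
    α.erase 0 ∈ mons J := by
  rw [← Finsupp.erase_add_single 0 α] at h
  exact hJ.of_add_single h

theorem sub_single_add_single {α : Mon n} {i : Fin (n + 1)} (h : α i ≠ 0) :
    α - Finsupp.single i 1 + Finsupp.single i 1 = α :=
  tsub_add_cancel_of_le (Finsupp.single_le_iff.2 (Nat.one_le_iff_ne_zero.2 h))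

theorem add_single_ne (α : Mon n) (i : Fin (n + 1)) : α + Finsupp.single i 1 ≠ α := by
  intro h
  simpa using DFunLike.congr_fun h i

theorem add_single_notMem_basisMons {α : Mon n} (h : α ∈ mons J) (i : Fin (n + 1)) :
    α + Finsupp.single i 1 ∉ basisMons J := fun hb =>
  add_single_ne α i (hb.2 α h le_self_add).symm

theorem exists_add_single_le {α β : Mon n} (h : α ≤ β) (hne : α ≠ β) :
    ∃ i, α + Finsupp.single i 1 ≤ β := by
  obtain ⟨i, hi⟩ : ∃ i, α i < β i := by
    by_contra! hcon
    exact hne (le_antisymm h hcon)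
  refine ⟨i, fun k => ?_⟩
  have := h k
  by_cases hk : i = k
  · subst hk; simp; omega
  · simpa [Finsupp.single_apply, hk] using this

theorem degree_add_single (α : Mon n) (i : Fin (n + 1)) :
    ((α + Finsupp.single i 1).degree : ℤ) = α.degree + 1 := by
  rw [map_add, Finsupp.degree_single]
  push_cast
  rfl

theorem SaturatedMons.basisMons_apply_zero (hJ : SaturatedMons J) {α : Mon n}
    (h : α ∈ basisMons J) : α 0 = 0 := by
  by_contra h0
  rw [← sub_single_add_single h0] at h
  exact add_single_notMem_basisMons (hJ _ h.1) 0 h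

variable {m : ℤ}

theorem mem_basisMons_truncation_of_degree_eq {α : Mon n} (h : α ∈ mons J)
    (hd : (α.degree : ℤ) = m) : α ∈ basisMons (truncation J m) := by
  refine ⟨mem_mons_truncation.2 ⟨h, hd.ge⟩, fun β hβ hle => ?_⟩
  by_contra hne
  obtain ⟨i, hi⟩ := exists_add_single_le hle hne
  have h1 := (mem_mons_truncation.1 hβ).2
  have h2 := Finsupp.degree_mono hi
  have h3 := degree_add_single β i
  omega

theorem mem_basisMons_truncation_of_mem_basisMons {α : Mon n} (h : α ∈ basisMons J)
    (hd : m ≤ (α.degree : ℤ)) : α ∈ basisMons (truncation J m) :=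
  ⟨mem_mons_truncation.2 ⟨h.1, hd⟩, fun β hβ hle => h.2 β (mem_mons_truncation.1 hβ).1 hle⟩

theorem mem_basisMons_truncation_of_le {α : Mon n} (h : α ∈ basisMons (truncation J (m - 1)))
    (hd : m ≤ (α.degree : ℤ)) : α ∈ basisMons (truncation J m) := by
  refine ⟨mem_mons_truncation.2 ⟨(mem_mons_truncation.1 h.1).1, hd⟩, fun β hβ hle => ?_⟩
  have := mem_mons_truncation.1 hβ
  exact h.2 β (mem_mons_truncation.2 ⟨this.1, by omega⟩) hle

theorem degree_of_mem_basisMons_truncation {α : Mon n} (h : α ∈ basisMons (truncation J m)) :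
    m ≤ (α.degree : ℤ) :=
  (mem_mons_truncation.1 h.1).2

theorem basisMons_truncation_cases {α : Mon n} (h : α ∈ basisMons (truncation J m)) :
    α ∈ basisMons (truncation J (m - 1)) ∨
      ∃ (i : Fin (n + 1)) (β : Mon n), β ∈ basisMons (truncation J (m - 1)) ∧
        (β.degree : ℤ) = m - 1 ∧ α = β + Finsupp.single i 1 := by
  have h1 := mem_mons_truncation.1 h.1
  obtain ⟨β, hβ, hle⟩ := exists_basisMons_le
    (mem_mons_truncation.2 ⟨h1.1, by omega⟩ : α ∈ mons (truncation J (m - 1)))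
  have h2 := mem_mons_truncation.1 hβ.1
  by_cases hd : m ≤ (β.degree : ℤ)
  · rw [← h.2 β (mem_mons_truncation.2 ⟨h2.1, hd⟩) hle]
    exact Or.inl hβ
  · have hne : β ≠ α := by
      rintro rfl
      exact hd h1.2
    obtain ⟨i, hi⟩ := exists_add_single_le hle hne
    refine Or.inr ⟨i, β, hβ, by omega, (h.2 _ (mem_mons_truncation.2 ⟨?_, ?_⟩) hi).symm⟩
    · exact mons_of_le h2.1 le_self_add
    · rw [degree_add_single]; omega

theorem finite_basisMons (J : Ideal (MvPolynomial (Fin (n + 1)) K)) : (basisMons J).Finite := by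
  refine IsAntichain.finite_of_partiallyWellOrderedOn (r := (· ≤ ·)) ?_
    (Set.isPWO_of_wellQuasiOrderedLE (basisMons J))
  intro α hα β hβ hne hle
  exact hne (hβ.2 α hα.1 hle)

theorem finite_degree_eq (d : ℕ) : {γ : Mon n | γ.degree = d}.Finite := by
  classical
  refine (Finset.finite_toSet (Finset.finsuppAntidiag Finset.univ d)).subset fun γ hγ => ?_
  have hγ' : γ.degree = d := hγ
  simpa [Finset.mem_finsuppAntidiag, Finsupp.degree_eq_sum] using hγ'

instance finite_param (J : Ideal (MvPolynomial (Fin (n + 1)) K)) : Finite (Param J) := by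
  have hfin := (finite_basisMons J).biUnion (t := fun α =>
    (fun γ : Mon n => (α, γ)) '' {γ : Mon n | γ.degree = α.degree})
    fun α _ => (finite_degree_eq _).image _
  refine hfin.subset ?_
  rintro ⟨α, γ⟩ ⟨hα, -, hd⟩
  simp only [Set.mem_iUnion]
  exact ⟨α, hα, γ, hd, rfl⟩

/-- Multiplying by a power of `x_0` brings any monomial of `J` into the truncation without changing
what remains after putting `x_0 = 1`. -/
theorem SaturatedMons.mons_underlineIdeal_truncation (hJ : SaturatedMons J) :
    mons (underlineIdeal (truncation J m)) = mons J := by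
  ext μ
  have key : μ ∈ mons (underlineIdeal (truncation J m)) ↔
      ∃ α ∈ basisMons (truncation J m), α.erase 0 ≤ μ := by
    unfold mons underlineIdeal
    rw [Set.mem_ofPred_eq, ← Set.image_image (fun β : Mon n => MvPolynomial.monomial β (1 : K))
      (fun α : Mon n => α.erase 0), MvPolynomial.mem_ideal_span_monomial_image]
    classical
    simp [MvPolynomial.support_monomial]
  rw [key]
  constructor
  · rintro ⟨α, hα, hle⟩
    exact mons_of_le (hJ.erase_mem (mem_mons_truncation.1 hα.1).1) hle
  · intro hμ
    obtain ⟨α, hα, hle⟩ := exists_basisMons_le (mem_mons_truncation.2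
      ⟨mons_of_le hμ le_self_add, by rw [map_add, Finsupp.degree_single]; push_cast; omega⟩ :
      μ + Finsupp.single 0 m.toNat ∈ mons (truncation J m))
    refine ⟨α, hα, fun i => ?_⟩
    have := hle i
    by_cases hi : i = 0
    · simp [hi]
    · simpa [hi, Finsupp.single_apply, Ne.symm hi] using this

theorem SaturatedMons.mem_superminimals_truncation (hJ : SaturatedMons J) {α : Mon n} :
    α ∈ superminimals (truncation J m) ↔
      α ∈ basisMons (truncation J m) ∧ α.erase 0 ∈ basisMons J := by
  simp only [superminimals, basisMons, hJ.mons_underlineIdeal_truncation, Set.mem_ofPred_eq]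

theorem SaturatedMons.add_single_notMem (hJ : SaturatedMons J) {γ : Mon n} (h : γ ∉ mons J) :
    γ + Finsupp.single 0 1 ∉ mons J := fun h' => h (hJ _ h')

theorem param_tail_notMem (p : Param (truncation J m)) : p.1.2 ∉ mons J := fun h => by
  have h1 := (mem_mons_truncation.1 p.2.1.1).2
  rw [← p.2.2.2] at h1
  exact p.2.2.1 (mem_mons_truncation.2 ⟨h, h1⟩)

theorem shift_mem {p : Param (truncation J (m - 1))} (hJ : SaturatedMons J)
    (hp : ¬ m ≤ (p.1.1.degree : ℤ)) :
    p.1.1 + Finsupp.single 0 1 ∈ basisMons (truncation J m) ∧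
      p.1.2 + Finsupp.single 0 1 ∉ mons (truncation J m) ∧
      (p.1.2 + Finsupp.single 0 1).degree = (p.1.1 + Finsupp.single 0 1).degree := by
  have h1 := mem_mons_truncation.1 p.2.1.1
  refine ⟨mem_basisMons_truncation_of_degree_eq (mons_of_le h1.1 le_self_add) ?_, fun h => ?_, ?_⟩
  · rw [degree_add_single]; omega
  · exact hJ.add_single_notMem (param_tail_notMem p) (mem_mons_truncation.1 h).1
  · rw [map_add, map_add, p.2.2.2]

open Classical in
/-- The identification of the parameters of `J_{≥ m-1}` with parameters of `J_{≥ m}`, by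
multiplying with `x_0` in degree `m - 1`. -/
def shiftParam (hJ : SaturatedMons J) (m : ℤ) (p : Param (truncation J (m - 1))) :
    Param (truncation J m) :=
  if hp : m ≤ (p.1.1.degree : ℤ) then
    ⟨p.1, mem_basisMons_truncation_of_le p.2.1 hp,
      fun h => param_tail_notMem p (mem_mons_truncation.1 h).1, p.2.2.2⟩
  else ⟨(p.1.1 + Finsupp.single 0 1, p.1.2 + Finsupp.single 0 1), shift_mem hJ hp⟩

theorem shiftParam_of_le (hJ : SaturatedMons J) {p : Param (truncation J (m - 1))}
    (hp : m ≤ (p.1.1.degree : ℤ)) : (shiftParam hJ m p).1 = p.1 := by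
  exact congrArg Subtype.val (dif_pos hp)

theorem shiftParam_of_not_le (hJ : SaturatedMons J) {p : Param (truncation J (m - 1))}
    (hp : ¬ m ≤ (p.1.1.degree : ℤ)) :
    (shiftParam hJ m p).1 = (p.1.1 + Finsupp.single 0 1, p.1.2 + Finsupp.single 0 1) := by
  exact congrArg Subtype.val (dif_neg hp)

theorem shiftParam_injective (hJ : SaturatedMons J) (m : ℤ) :
    Function.Injective (shiftParam hJ m) := by
  have key : ∀ p q : Param (truncation J (m - 1)), m ≤ (p.1.1.degree : ℤ) →
      ¬ m ≤ (q.1.1.degree : ℤ) → shiftParam hJ m p ≠ shiftParam hJ m q := by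
    intro p q hp hq h
    have h1 := congrArg (fun r => r.1.1) h
    simp only [shiftParam_of_le hJ hp, shiftParam_of_not_le hJ hq] at h1
    have h2 := p.2.1
    rw [h1] at h2
    exact add_single_notMem_basisMons q.2.1.1 0 h2
  intro p q h
  by_cases hp : m ≤ (p.1.1.degree : ℤ) <;> by_cases hq : m ≤ (q.1.1.degree : ℤ)
  · have h1 := congrArg Subtype.val h
    rw [shiftParam_of_le hJ hp, shiftParam_of_le hJ hq] at h1
    exact Subtype.ext h1
  · exact absurd h (key p q hp hq)
  · exact absurd h.symm (key q p hq hp)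
  · have h1 := congrArg Subtype.val h
    rw [shiftParam_of_not_le hJ hp, shiftParam_of_not_le hJ hq, Prod.mk.injEq] at h1
    exact Subtype.ext (Prod.ext (add_right_cancel h1.1) (add_right_cancel h1.2))

theorem erase_add_single_zero (α : Mon n) :
    (α + Finsupp.single 0 1).erase 0 = α.erase 0 := by
  ext i
  by_cases hi : i = 0
  · simp [hi]
  · simp [hi]

theorem shiftParam_mem_superminimals (hJ : SaturatedMons J)
    {p : Param (truncation J (m - 1))} (hp : p.1.1 ∈ superminimals (truncation J (m - 1))) :
    (shiftParam hJ m p).1.1 ∈ superminimals (truncation J m) := by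
  rw [hJ.mem_superminimals_truncation] at hp ⊢
  refine ⟨(shiftParam hJ m p).2.1, ?_⟩
  by_cases hd : m ≤ (p.1.1.degree : ℤ)
  · rw [shiftParam_of_le hJ hd]
    exact hp.2
  · rw [shiftParam_of_not_le hJ hd, erase_add_single_zero]
    exact hp.2

/-- The identification of the parameters of the superminimals of `J_{≥ m-1}` with parameters of the
superminimals of `J_{≥ m}`. -/
def shiftSParam (hJ : SaturatedMons J) (m : ℤ) :
    SParam (truncation J (m - 1)) ↪ SParam (truncation J m) where
  toFun c := ⟨shiftParam hJ m c.1, shiftParam_mem_superminimals hJ c.2⟩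
  inj' _ _ h := Subtype.ext (shiftParam_injective hJ m (congrArg Subtype.val h))

theorem isParamIdentification_shiftSParam (hJ : SaturatedMons J) (m : ℤ) :
    IsParamIdentification J m (shiftSParam hJ m) :=
  fun _ => ⟨fun h => shiftParam_of_le hJ h, fun h => shiftParam_of_not_le hJ (by omega)⟩

/-- The parameters of `J_{≥ m}` whose vanishing means that the polynomials with head in
`x_0 J_{m-1}` are divisible by `x_0`. -/
def cutParams (J : Ideal (MvPolynomial (Fin (n + 1)) K)) (m : ℤ) : Set (Param (truncation J m)) :=
  {p | ∃ α ∈ mons J, (α.degree : ℤ) = m - 1 ∧ p.1.1 = α + Finsupp.single 0 1 ∧ p.1.2 0 = 0}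

theorem shiftParam_notMem_cutParams (hJ : SaturatedMons J) (p : Param (truncation J (m - 1))) :
    shiftParam hJ m p ∉ cutParams J m := by
  rintro ⟨α, hα, hd, h1, h2⟩
  by_cases hp : m ≤ (p.1.1.degree : ℤ)
  · rw [shiftParam_of_le hJ hp] at h1
    have h3 := p.2.1
    rw [h1] at h3
    exact add_single_notMem_basisMons (mem_mons_truncation.2 ⟨hα, hd.ge⟩) 0 h3
  · rw [shiftParam_of_not_le hJ hp] at h2
    simp at h2

/-- A superminimal head that is not already a generator of `J_{≥ m-1}` has degree `m` and is
divisible by `x_0`; otherwise it would be a minimal generator of `J` and a proper multiple of an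
element of `J`. What then decides is whether `x_0` divides the tail monomial. -/
theorem mem_cutParams_iff (hJ : SaturatedMons J) (c : SParam (truncation J m)) :
    c.1 ∈ cutParams J m ↔ c ∉ Set.range (shiftSParam hJ m) := by
  constructor
  · rintro h ⟨q, rfl⟩
    exact shiftParam_notMem_cutParams hJ q.1 h
  intro hc
  obtain ⟨⟨⟨a, g⟩, ha, hg, hdeg⟩, hsm⟩ := c
  have hsm' := hJ.mem_superminimals_truncation.1 hsm
  simp only at ha hg hdeg hsm'
  have hgJ : g ∉ mons J := param_tail_notMem (⟨(a, g), ha, hg, hdeg⟩ : Param (truncation J m))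
  have hgT : ∀ g' : Mon n, g' ∉ mons J → g' ∉ mons (truncation J (m - 1)) :=
    fun g' h h' => h (mem_mons_truncation.1 h').1
  rcases basisMons_truncation_cases ha with h | ⟨i, β, hβ, hβd, hβa⟩
  · refine absurd ⟨⟨⟨(a, g), h, hgT g hgJ, hdeg⟩,
      hJ.mem_superminimals_truncation.2 ⟨h, hsm'.2⟩⟩, ?_⟩ hc
    exact Subtype.ext (Subtype.ext
      (shiftParam_of_le hJ (degree_of_mem_basisMons_truncation ha)))
  have had : (a.degree : ℤ) = m := by rw [hβa, degree_add_single]; omega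
  have ha0 : a 0 ≠ 0 := by
    intro h0
    have h1 : a.erase 0 = a := by
      ext k
      by_cases hk : k = 0
      · simp [hk, h0]
      · simp [hk]
    have h2 := hsm'.2
    rw [h1, hβa] at h2
    exact add_single_notMem_basisMons (mem_mons_truncation.1 hβ.1).1 i h2
  obtain ⟨α, rfl⟩ : ∃ α, a = α + Finsupp.single 0 1 := ⟨_, (sub_single_add_single ha0).symm⟩
  have hα : α ∈ mons J := hJ _ (mem_mons_truncation.1 ha.1).1
  have hαd : (α.degree : ℤ) = m - 1 := by rw [degree_add_single] at had; omega
  refine ⟨α, hα, hαd, rfl, ?_⟩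
  by_contra hg0
  obtain ⟨g, rfl⟩ : ∃ g', g = g' + Finsupp.single 0 1 := ⟨_, (sub_single_add_single hg0).symm⟩
  have hαB := mem_basisMons_truncation_of_degree_eq hα hαd
  refine hc ⟨⟨⟨(α, g), hαB, hgT g fun h => hgJ (mons_of_le h le_self_add), ?_⟩,
    hJ.mem_superminimals_truncation.2 ⟨hαB, ?_⟩⟩, ?_⟩
  · rw [map_add, map_add] at hdeg
    exact add_right_cancel hdeg
  · rw [← erase_add_single_zero]
    exact hsm'.2
  · refine Subtype.ext (Subtype.ext (shiftParam_of_not_le hJ ?_))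
    change ¬ m ≤ (α.degree : ℤ)
    omega

end Truncation

/-! ### Marked bases of consecutive truncations -/

section Transfer

variable {K : Type u} [Field K] {n : ℕ} {J : Ideal (MvPolynomial (Fin (n + 1)) K)}
  {A : Type*} [CommRing A] {B : Type*} [CommRing B] {m : ℤ}

theorem map_mem_markedSpan (f : A →+* B) (c : Param J → A)
    {h : MvPolynomial (Fin (n + 1)) A} (hh : h ∈ markedSpan c) :
    MvPolynomial.map f h ∈ markedSpan fun p => f (c p) := by
  have := Ideal.mem_map_of_mem (MvPolynomial.map f) hh
  rw [markedSpan, Ideal.map_span, Set.image_image] at this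
  simp only [map_markedPoly] at this
  exact this

theorem monomial_mul_mem_normalForms (hJ : SaturatedMons J) {h : MvPolynomial (Fin (n + 1)) A}
    (hh : h ∈ normalForms J A) (k : ℕ) :
    MvPolynomial.monomial (Finsupp.single 0 k) 1 * h ∈ normalForms J A := by
  classical
  intro γ hγ
  rw [MvPolynomial.coeff_monomial_mul', one_mul]
  split_ifs with hle
  · refine hh _ (hJ.of_add_single (k := k) ?_)
    rwa [tsub_add_cancel_of_le hle]
  · rfl

theorem monomial_mul_left_injective (μ : Mon n) {g h : MvPolynomial (Fin (n + 1)) A}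
    (hh : MvPolynomial.monomial μ 1 * g = MvPolynomial.monomial μ 1 * h) : g = h := by
  ext γ
  have := congrArg (MvPolynomial.coeff (μ + γ)) hh
  simpa [MvPolynomial.coeff_monomial_mul] using this

theorem normalForms_le_truncation : normalForms J A ≤ normalForms (truncation J m) A :=
  fun _ hh γ hγ => hh γ (mem_mons_truncation.1 hγ).1

theorem mem_normalForms_of_truncation {h : MvPolynomial (Fin (n + 1)) A}
    (hh : h ∈ normalForms (truncation J m) A)
    (hd : ∀ γ : Mon n, h.coeff γ ≠ 0 → m ≤ γ.degree) : h ∈ normalForms J A := by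
  intro γ hγ
  by_contra hne
  exact hne (hh γ (mem_mons_truncation.2 ⟨hγ, hd γ hne⟩))

theorem degree_eq_of_isHomogeneous {h : MvPolynomial (Fin (n + 1)) A} {d : ℕ}
    (hh : h.IsHomogeneous d) {γ : Mon n} (hγ : h.coeff γ ≠ 0) : γ.degree = d := by
  have := hh hγ
  change Finsupp.weight (fun _ => 1) γ = _ at this
  rwa [← Finsupp.degree_eq_weight_one] at this

theorem tailCoeff_truncation_of_mem (c : Param (truncation J m) → A) (α : Mon n) {γ : Mon n}
    (hγ : γ ∈ mons J) : tailCoeff c α γ = 0 :=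
  dif_neg fun h => param_tail_notMem (⟨(α, γ), h⟩ : Param (truncation J m)) hγ

theorem markedTail_mem (c : Param (truncation J m) → A) (α : Mon n) :
    markedTail c α ∈ normalForms J A := fun γ hγ => by
  rw [coeff_markedTail, tailCoeff_truncation_of_mem c α hγ]

theorem le_degree_of_mem_markedSpan {c : Param (truncation J m) → A}
    {h : MvPolynomial (Fin (n + 1)) A} (hh : h ∈ markedSpan c) (γ : Mon n)
    (hγ : h.coeff γ ≠ 0) : m ≤ γ.degree := by
  refine le_degree_of_mem_span ?_ hh γ hγ
  rintro _ ⟨α, hα, rfl⟩ μ hμ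
  rw [degree_eq_of_isHomogeneous (isHomogeneous_markedPoly c α) hμ]
  exact degree_of_mem_basisMons_truncation hα

/-- The ideal lives in degrees at least `m`, where `J` and `J_{≥ m}` have the same monomials. Being
normal can thus be tested against `J`, independently of `m`, which makes consecutive truncations
comparable. -/
theorem isMarkedBasis_truncation_iff {c : Param (truncation J m) → A} :
    IsMarkedBasis c ↔ ∀ h ∈ markedSpan c, h ∈ normalForms J A → h = 0 :=
  ⟨fun hc h hh hN => hc h hh (normalForms_le_truncation hN), fun hc h hh hN =>
    hc h hh (mem_normalForms_of_truncation hN (le_degree_of_mem_markedSpan hh))⟩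

theorem IsMarkedBasis.normalForm_unique {c : Param (truncation J m) → A} (hc : IsMarkedBasis c)
    {f t t' : MvPolynomial (Fin (n + 1)) A} (ht : t ∈ normalForms J A)
    (ht' : t' ∈ normalForms J A) (h : f - t ∈ markedSpan c) (h' : f - t' ∈ markedSpan c) :
    t = t' := by
  refine sub_eq_zero.1 (isMarkedBasis_truncation_iff.1 hc _ ?_ (sub_mem ht ht'))
  have := sub_mem h' h
  rwa [sub_sub_sub_cancel_left] at this

theorem exists_normalForm_truncation (hS : StableMons J) (c : Param (truncation J m) → A)
    {μ : Mon n} (hμ : m ≤ (μ.degree : ℤ)) :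
    ∃ H ∈ normalForms J A, H.IsHomogeneous μ.degree ∧
      MvPolynomial.monomial μ 1 - H ∈ markedSpan c := by
  obtain ⟨H, h1, h2, h3⟩ := exists_normalForm (hS.truncation m) c μ
  refine ⟨H, mem_normalForms_of_truncation h1 fun γ hγ => ?_, h2, h3⟩
  rwa [degree_eq_of_isHomogeneous h2 hγ]

/-- The marked basis of `J_{≥ m}` induced by one of `J_{≥ m-1}`, by taking the normal forms of the
monomial generators. -/
def truncateCoeffs (hS : StableMons J) (m : ℤ) (c : Param (truncation J (m - 1)) → A)
    (p : Param (truncation J m)) : A :=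
  (exists_normalForm (hS.truncation (m - 1)) c p.1.1).choose.coeff p.1.2

theorem markedPoly_truncateCoeffs_mem (hS : StableMons J) (c : Param (truncation J (m - 1)) → A)
    {α : Mon n} (hα : α ∈ basisMons (truncation J m)) :
    markedPoly (truncateCoeffs hS m c) α ∈ markedSpan c := by
  obtain ⟨h1, h2, h3⟩ := (exists_normalForm (hS.truncation (m - 1)) c α).choose_spec
  have : markedTail (truncateCoeffs hS m c) α =
      (exists_normalForm (hS.truncation (m - 1)) c α).choose := by
    ext γ
    rw [coeff_markedTail, tailCoeff]
    split_ifs with h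
    · rfl
    · by_contra hne
      have hd := degree_eq_of_isHomogeneous h2 (Ne.symm hne)
      refine h ⟨hα, fun hγ => hne ?_, hd⟩
      have h4 := mem_mons_truncation.1 hγ
      exact (h1 γ (mem_mons_truncation.2 ⟨h4.1, by omega⟩)).symm
  rw [markedPoly, this]
  exact h3

theorem isMarkedBasis_of_markedPoly_mem {c : Param (truncation J (m - 1)) → A}
    (hc : IsMarkedBasis c) {c₁ : Param (truncation J m) → A}
    (h : ∀ α ∈ basisMons (truncation J m), markedPoly c₁ α ∈ markedSpan c) :
    IsMarkedBasis c₁ := by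
  rw [isMarkedBasis_truncation_iff] at hc ⊢
  refine fun f hf hN => hc f (Ideal.span_le.2 ?_ hf) hN
  rintro _ ⟨α, hα, rfl⟩
  exact h α hα

theorem markedTail_eq_of_le {c : Param (truncation J (m - 1)) → A}
    (hc : IsMarkedBasis c) {c₁ : Param (truncation J m) → A}
    (h : ∀ α ∈ basisMons (truncation J m), markedPoly c₁ α ∈ markedSpan c) {α : Mon n}
    (hα : α ∈ basisMons (truncation J (m - 1))) (hd : m ≤ (α.degree : ℤ)) :
    markedTail c₁ α = markedTail c α :=
  hc.normalForm_unique (markedTail_mem c₁ α) (markedTail_mem c α)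
    (h α (mem_basisMons_truncation_of_le hα hd)) (markedPoly_mem_markedSpan c hα)

/-- By saturation `x_0` times the old tail is still normal, so it is the unique normal form of `x_0
x^α`. -/
theorem markedTail_add_single_eq (hJ : SaturatedMons J) {c : Param (truncation J (m - 1)) → A}
    (hc : IsMarkedBasis c) {c₁ : Param (truncation J m) → A}
    (h : ∀ α ∈ basisMons (truncation J m), markedPoly c₁ α ∈ markedSpan c) {α : Mon n}
    (hα : α ∈ mons J) (hd : (α.degree : ℤ) = m - 1) :
    markedTail c₁ (α + Finsupp.single 0 1) =
      MvPolynomial.monomial (Finsupp.single 0 1) 1 * markedTail c α := by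
  refine hc.normalForm_unique (f := MvPolynomial.monomial (α + Finsupp.single 0 1) 1)
    (markedTail_mem c₁ _) (monomial_mul_mem_normalForms hJ (markedTail_mem c α) 1) ?_ ?_
  · refine h _ (mem_basisMons_truncation_of_degree_eq (mons_of_le hα le_self_add) ?_)
    rw [degree_add_single]; omega
  · have := (markedSpan c).mul_mem_left (MvPolynomial.monomial (Finsupp.single 0 1) 1)
      (markedPoly_mem_markedSpan c (mem_basisMons_truncation_of_degree_eq hα hd))
    rwa [markedPoly, mul_sub, MvPolynomial.monomial_mul, one_mul,
      add_comm (Finsupp.single 0 1)] at this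

/-- Assuming only that the new polynomials lie in the old ideal makes the choice of normal forms in
`truncateCoeffs` irrelevant. -/
theorem apply_shiftParam (hJ : SaturatedMons J) {c : Param (truncation J (m - 1)) → A}
    (hc : IsMarkedBasis c) {c₁ : Param (truncation J m) → A}
    (h : ∀ α ∈ basisMons (truncation J m), markedPoly c₁ α ∈ markedSpan c)
    (p : Param (truncation J (m - 1))) : c₁ (shiftParam hJ m p) = c p := by
  rw [← tailCoeff_param c₁, ← tailCoeff_param c, ← coeff_markedTail, ← coeff_markedTail]
  by_cases hp : m ≤ (p.1.1.degree : ℤ)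
  · rw [shiftParam_of_le hJ hp, markedTail_eq_of_le hc h p.2.1 hp]
  · have h1 := mem_mons_truncation.1 p.2.1.1
    rw [shiftParam_of_not_le hJ hp]
    simp only
    rw [markedTail_add_single_eq hJ hc h h1.1 (by omega), add_comm p.1.2,
      MvPolynomial.coeff_monomial_mul, one_mul]

theorem coeff_monomial_mul_eq_zero {γ : Mon n} (h : γ 0 = 0) (f : MvPolynomial (Fin (n + 1)) A) :
    (MvPolynomial.monomial (Finsupp.single 0 1) 1 * f).coeff γ = 0 := by
  classical
  rw [MvPolynomial.coeff_monomial_mul', if_neg]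
  intro hle
  have := hle 0
  simp [h] at this

theorem apply_cutParams (hJ : SaturatedMons J) {c : Param (truncation J (m - 1)) → A}
    (hc : IsMarkedBasis c) {c₁ : Param (truncation J m) → A}
    (h : ∀ α ∈ basisMons (truncation J m), markedPoly c₁ α ∈ markedSpan c)
    {p : Param (truncation J m)} (hp : p ∈ cutParams J m) : c₁ p = 0 := by
  obtain ⟨α, hα, hd, h1, h2⟩ := hp
  rw [← tailCoeff_param c₁, ← coeff_markedTail, h1, markedTail_add_single_eq hJ hc h hα hd,
    coeff_monomial_mul_eq_zero h2]

/-! ### Descent from `J_{≥ m}` to `J_{≥ m-1}` by cancelling `x_0` -/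

section Pull

variable (hJ : SaturatedMons J) {c : Param (truncation J m) → A}

theorem markedPoly_shift_of_le {α : Mon n} (hα : α ∈ basisMons (truncation J (m - 1)))
    (hd : m ≤ (α.degree : ℤ)) :
    markedPoly (fun p => c (shiftParam hJ m p)) α = markedPoly c α := by
  rw [markedPoly, markedPoly]
  congr 1
  ext γ
  rw [coeff_markedTail, coeff_markedTail]
  by_cases hγ : γ ∈ mons J
  · rw [tailCoeff_truncation_of_mem _ _ hγ, tailCoeff_truncation_of_mem _ _ hγ]
  by_cases hdγ : γ.degree = α.degree
  · have h1 : ∀ k, γ ∉ mons (truncation J k) := fun k h => hγ (mem_mons_truncation.1 h).1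
    rw [tailCoeff, tailCoeff, dif_pos ⟨hα, h1 _, hdγ⟩,
      dif_pos ⟨mem_basisMons_truncation_of_le hα hd, h1 _, hdγ⟩]
    congr 1
    exact Subtype.ext (shiftParam_of_le hJ hd)
  · rw [tailCoeff_of_degree_ne _ hdγ, tailCoeff_of_degree_ne _ hdγ]

theorem monomial_mul_markedPoly_shift (hZ : ∀ p ∈ cutParams J m, c p = 0) {α : Mon n}
    (hα : α ∈ basisMons (truncation J (m - 1))) (hd : ¬ m ≤ (α.degree : ℤ)) :
    MvPolynomial.monomial (Finsupp.single 0 1) 1 *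
        markedPoly (fun p => c (shiftParam hJ m p)) α =
      markedPoly c (α + Finsupp.single 0 1) := by
  have hα' := mem_mons_truncation.1 hα.1
  have hαB : α + Finsupp.single 0 1 ∈ basisMons (truncation J m) :=
    mem_basisMons_truncation_of_degree_eq (mons_of_le hα'.1 le_self_add)
      (by rw [degree_add_single]; omega)
  rw [markedPoly, markedPoly, mul_sub, MvPolynomial.monomial_mul, one_mul,
    add_comm (Finsupp.single 0 1)]
  congr 1
  ext γ
  by_cases h0 : γ 0 = 0
  · rw [coeff_monomial_mul_eq_zero h0, coeff_markedTail, tailCoeff]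
    split_ifs with h
    · exact (hZ _ ⟨α, hα'.1, by omega, rfl, h0⟩).symm
    · rfl
  · obtain ⟨γ, rfl⟩ : ∃ γ', γ = γ' + Finsupp.single 0 1 := ⟨_, (sub_single_add_single h0).symm⟩
    rw [coeff_markedTail, add_comm γ, MvPolynomial.coeff_monomial_mul, one_mul, coeff_markedTail,
      add_comm (Finsupp.single 0 1) γ]
    by_cases hγ : γ ∈ mons J
    · rw [tailCoeff_truncation_of_mem _ _ hγ,
        tailCoeff_truncation_of_mem _ _ (mons_of_le hγ le_self_add)]
    by_cases hdγ : γ.degree = α.degree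
    · have h1 : γ ∉ mons (truncation J (m - 1)) := fun h => hγ (mem_mons_truncation.1 h).1
      have h2 : γ + Finsupp.single 0 1 ∉ mons (truncation J m) := fun h =>
        hJ.add_single_notMem hγ (mem_mons_truncation.1 h).1
      rw [tailCoeff, tailCoeff, dif_pos ⟨hα, h1, hdγ⟩,
        dif_pos ⟨hαB, h2, by rw [map_add, map_add, hdγ]⟩]
      congr 1
      exact Subtype.ext (shiftParam_of_not_le hJ hd)
    · rw [tailCoeff_of_degree_ne _ hdγ, tailCoeff_of_degree_ne]
      rw [map_add, map_add]
      exact fun h => hdγ (add_right_cancel h)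

theorem monomial_mul_mem_markedSpan_of_shift (hZ : ∀ p ∈ cutParams J m, c p = 0)
    {h : MvPolynomial (Fin (n + 1)) A}
    (hh : h ∈ markedSpan fun p => c (shiftParam hJ m p)) :
    MvPolynomial.monomial (Finsupp.single 0 1) 1 * h ∈ markedSpan c := by
  induction hh using Submodule.span_induction with
  | mem x hx =>
    obtain ⟨α, hα, rfl⟩ := hx
    by_cases hd : m ≤ (α.degree : ℤ)
    · rw [markedPoly_shift_of_le hJ hα hd]
      exact Ideal.mul_mem_left _ _
        (markedPoly_mem_markedSpan c (mem_basisMons_truncation_of_le hα hd))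
    · rw [monomial_mul_markedPoly_shift hJ hZ hα hd]
      refine markedPoly_mem_markedSpan c (mem_basisMons_truncation_of_degree_eq
        (mons_of_le (mem_mons_truncation.1 hα.1).1 le_self_add) ?_)
      have := degree_of_mem_basisMons_truncation hα
      rw [degree_add_single]; omega
  | zero => simp
  | add x y _ _ hx hy => rw [mul_add]; exact add_mem hx hy
  | smul a x _ hx =>
    rw [smul_eq_mul, mul_left_comm]
    exact Ideal.mul_mem_left _ _ hx

/-- Multiplication by `x_0` is injective, preserves normal forms, and carries the ideal of the
shifted marked set into that of `c`. -/
theorem isMarkedBasis_shift (hc : IsMarkedBasis c) (hZ : ∀ p ∈ cutParams J m, c p = 0) :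
    IsMarkedBasis fun p => c (shiftParam hJ m p) := by
  rw [isMarkedBasis_truncation_iff] at hc ⊢
  intro h hh hN
  refine monomial_mul_left_injective (Finsupp.single 0 1) ?_
  rw [mul_zero]
  exact hc _ (monomial_mul_mem_markedSpan_of_shift hJ hZ hh) (monomial_mul_mem_normalForms hJ hN 1)

/-- The shifted marked set determines `c`: `x_0` times the normal form of `x^α` modulo the shifted
set and `x_0` times the tail in `c` are both normal forms of `x_0 x^α` modulo `c`, and `x_0`
cancels. -/
theorem markedPoly_mem_markedSpan_shift (hS : StableMons J) (hc : IsMarkedBasis c)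
    (hZ : ∀ p ∈ cutParams J m, c p = 0) {α : Mon n} (hα : α ∈ basisMons (truncation J m)) :
    markedPoly c α ∈ markedSpan fun p => c (shiftParam hJ m p) := by
  have hd := degree_of_mem_basisMons_truncation hα
  obtain ⟨H, hH, -, hmem⟩ := exists_normalForm_truncation hS
    (fun p => c (shiftParam hJ m p)) (μ := α) (by omega)
  have h1 := monomial_mul_mem_markedSpan_of_shift hJ hZ hmem
  have h2 := (markedSpan c).mul_mem_left (MvPolynomial.monomial (Finsupp.single 0 1) 1)
    (markedPoly_mem_markedSpan c hα)
  rw [markedPoly, mul_sub] at h2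
  rw [mul_sub] at h1
  have h3 := monomial_mul_left_injective _ (hc.normalForm_unique
    (monomial_mul_mem_normalForms hJ hH 1)
    (monomial_mul_mem_normalForms hJ (markedTail_mem c α) 1) h1 h2)
  rw [markedPoly, ← h3]
  exact hmem

end Pull

/-! ### Vanishing of the cut parameters when no generator of degree `m + 1` involves `x_1` -/

theorem add_single_one_notMem (hS : StableMons J)
    (hx : ∀ α ∈ basisMons J, (α.degree : ℤ) = m + 1 → α 1 = 0) (h10 : (1 : Fin (n + 1)) ≠ 0)
    {γ : Mon n} (hγ : γ ∉ mons J) (hγd : (γ.degree : ℤ) = m) (h0 : γ 0 = 0) :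
    γ + Finsupp.single 1 1 ∉ mons J := by
  intro hmem
  obtain ⟨δ, β, hs, hadd⟩ := exists_isStar hS _ hmem
  have hlt := hs.toColex_lt (ε := Finsupp.single 1 1) (μ := γ)
    (by rw [hadd, add_comm γ]) fun hle => hγ (mons_of_le hs.1.1 hle)
  obtain ⟨j, hj, hjlt⟩ := Finsupp.Colex.lt_iff.1 hlt
  change δ j < Finsupp.single (1 : Fin (n + 1)) 1 j at hjlt
  obtain rfl : j = 1 := by
    by_contra hne
    simp [Ne.symm hne] at hjlt
  -- A cofactor below `x_1` is a power of `x_0`, and `x_0` does not divide `x_1 x^γ`. So `x_1 x^γ`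
  -- itself would be an excluded generator of degree `m + 1`.
  have hδ : δ = 0 := by
    ext i
    rcases lt_trichotomy i 1 with h | h | h
    · have hi0 : i = 0 := by
        have h3 := Fin.lt_def.1 h
        have h4 : ((1 : Fin (n + 1)) : ℕ) ≤ 1 := by
          rw [Fin.val_one']
          exact Nat.mod_le _ _
        exact Fin.ext (by rw [Fin.val_zero]; omega)
      have h5 := DFunLike.congr_fun hadd 0
      simp [h10, h0] at h5
      rw [hi0]
      simpa using h5.1
    · subst h
      simpa using hjlt
    · have h5 := hj i h
      change δ i = Finsupp.single (1 : Fin (n + 1)) 1 i at h5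
      rw [h5, Finsupp.single_apply, if_neg h.ne]
      rfl
  rw [hδ, zero_add] at hadd
  have h6 := hx β hs.1 (by rw [hadd, degree_add_single]; omega)
  rw [hadd] at h6
  simp at h6

/-- Only coefficients at `x_1 x^g` with `x_0 ∤ x^g` are controlled. If `x_0 ∤ x^γ`, then `x_1 x^γ`
is already normal. Otherwise reduce `x_1 x^γ / x_0`, whose degree is still `m`, and multiply back by
`x_0`; every monomial of the result is divisible by `x_0`. -/
theorem exists_normalForm_mul_one (hS : StableMons J) (hJ : SaturatedMons J)
    (hx : ∀ α ∈ basisMons J, (α.degree : ℤ) = m + 1 → α 1 = 0) (h10 : (1 : Fin (n + 1)) ≠ 0)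
    (c : Param (truncation J m) → A) {γ : Mon n} (hγ : γ ∉ mons J) (hγd : (γ.degree : ℤ) = m) :
    ∃ h ∈ normalForms J A,
      MvPolynomial.monomial (γ + Finsupp.single 1 1) 1 - h ∈ markedSpan c ∧
      ∀ g : Mon n, g 0 = 0 → h.coeff (g + Finsupp.single 1 1) =
        open Classical in if γ = g then 1 else 0 := by
  classical
  by_cases h0 : γ 0 = 0
  · refine ⟨MvPolynomial.monomial (γ + Finsupp.single 1 1) 1,
      monomial_mem_normalForms (add_single_one_notMem hS hx h10 hγ hγd h0) 1, by simp,
      fun g _ => ?_⟩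
    rw [MvPolynomial.coeff_monomial]
    simp
  · obtain ⟨γ, rfl⟩ : ∃ γ', γ = γ' + Finsupp.single 0 1 :=
      ⟨_, (sub_single_add_single h0).symm⟩
    rw [degree_add_single] at hγd
    obtain ⟨H, hH, -, hmem⟩ := exists_normalForm_truncation hS c
      (μ := γ + Finsupp.single 1 1) (by rw [degree_add_single]; omega)
    refine ⟨_, monomial_mul_mem_normalForms hJ hH 1, ?_, fun g hg => ?_⟩
    · have := Ideal.mul_mem_left _ (MvPolynomial.monomial (Finsupp.single 0 1) 1) hmem
      rw [mul_sub, MvPolynomial.monomial_mul, one_mul] at this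
      have hexp : Finsupp.single 0 1 + (γ + Finsupp.single 1 1) =
          γ + Finsupp.single 0 1 + Finsupp.single 1 1 := by abel
      rwa [hexp] at this
    · rw [coeff_monomial_mul_eq_zero (by simp [hg, h10]), if_neg]
      rintro rfl
      exact h0 hg

/-- If no monomial of degree `m + 1` in the basis of `J` is divisible by `x_1`, then the parameters
that cut out `Mf(J_{≥ m-1})` vanish on every marked basis of `J_{≥ m}`. -/
theorem apply_cutParams_eq_zero (hS : StableMons J) (hJ : SaturatedMons J)
    (hx : ∀ α ∈ basisMons J, (α.degree : ℤ) = m + 1 → α 1 = 0)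
    {c : Param (truncation J m) → A} (hc : IsMarkedBasis c) {p : Param (truncation J m)}
    (hp : p ∈ cutParams J m) : c p = 0 := by
  classical
  obtain ⟨⟨a, g⟩, hap⟩ := p
  obtain ⟨α, hα, hd, h1, h2⟩ := hp
  simp only at h1 h2
  subst h1
  have hg : g ∉ mons J := param_tail_notMem (⟨(_, g), hap⟩ : Param (truncation J m))
  have hgd : (g.degree : ℤ) = m := by
    have h3 := hap.2.2
    have h4 := degree_add_single α 0
    simp only at h3
    omega
  -- For `n = 0` the index `1` is `0`. There is then one monomial in each degree, so no parameter of
  -- this kind exists.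
  by_cases h10 : (1 : Fin (n + 1)) = 0
  · have hn : n = 0 := by simpa using h10
    subst hn
    have h3 : g = α + Finsupp.single 0 1 := by
      have h3 := hap.2.2
      simp only [Finsupp.degree_eq_sum] at h3
      ext i
      fin_cases i
      simpa using h3
    rw [h3] at hg
    exact absurd (mons_of_le hα le_self_add) hg
  have key : ∀ γ : Mon n, ∃ h ∈ normalForms J A, γ ∉ mons J → (γ.degree : ℤ) = m →
      MvPolynomial.monomial (γ + Finsupp.single 1 1) 1 - h ∈ markedSpan c ∧
      h.coeff (g + Finsupp.single 1 1) = if γ = g then 1 else 0 := by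
    intro γ
    by_cases hγ : γ ∉ mons J ∧ (γ.degree : ℤ) = m
    · obtain ⟨h, h3, h4, h5⟩ := exists_normalForm_mul_one hS hJ hx h10 c hγ.1 hγ.2
      exact ⟨h, h3, fun _ _ => ⟨h4, h5 g h2⟩⟩
    · exact ⟨0, zero_mem _, fun h h' => absurd ⟨h, h'⟩ hγ⟩
  choose h hN hspec using key
  set a := α + Finsupp.single 0 1 with ha
  have hspan1 : MvPolynomial.monomial (Finsupp.single 1 1) 1 * markedPoly c a ∈ markedSpan c :=
    Ideal.mul_mem_left _ _ (markedPoly_mem_markedSpan c hap.1)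
  rw [markedPoly, mul_sub, MvPolynomial.monomial_mul, one_mul, monomial_mul_markedTail] at hspan1
  have hαB : α + Finsupp.single 1 1 ∈ basisMons (truncation J m) :=
    mem_basisMons_truncation_of_degree_eq (mons_of_le hα le_self_add)
      (by rw [degree_add_single]; omega)
  have hspan2 := (markedSpan c).mul_mem_left (MvPolynomial.monomial (Finsupp.single 0 1) 1)
    (markedPoly_mem_markedSpan c hαB)
  rw [markedPoly, mul_sub, MvPolynomial.monomial_mul, one_mul] at hspan2
  have hexp : Finsupp.single 0 1 + (α + Finsupp.single 1 1) = Finsupp.single 1 1 + a := by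
    rw [ha]; abel
  rw [hexp] at hspan2
  have hcoef : ∀ γ, tailCoeff c a γ ≠ 0 → γ ∉ mons J ∧ (γ.degree : ℤ) = m := by
    intro γ hγ
    refine ⟨fun h' => hγ (tailCoeff_truncation_of_mem c a h'), ?_⟩
    have h3 : γ.degree = a.degree := by
      by_contra h'
      exact hγ (tailCoeff_of_degree_ne c h')
    rw [h3, ← hgd, hap.2.2]
  -- Two normal forms of `x_0 x_1 x^α`, from `x_1 F_{x_0 x^α}` and from `x_0 F_{x_1 x^α}`. The
  -- second is divisible by `x_0`, so comparison at `x_1 x^g` isolates the parameter and shows that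
  -- it is zero.
  have heq := hc.normalForm_unique (f := MvPolynomial.monomial (Finsupp.single 1 1 + a) 1)
    (t := ∑ γ ∈ Finset.finsuppAntidiag Finset.univ a.degree, tailCoeff c a γ • h γ)
    (sum_mem fun γ _ => Submodule.smul_mem _ _ (hN γ))
    (monomial_mul_mem_normalForms hJ (markedTail_mem c _) 1) (by
      rw [← sub_add_sub_cancel, ← Finset.sum_sub_distrib]
      refine add_mem hspan1 (sum_mem fun γ _ => ?_)
      by_cases hγ : tailCoeff c a γ = 0
      · simp [hγ]
      · rw [← smul_sub, MvPolynomial.smul_eq_C_mul,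
          add_comm (Finsupp.single 1 1) γ]
        exact Ideal.mul_mem_left _ _ (hspec γ (hcoef γ hγ).1 (hcoef γ hγ).2).1) hspan2
  have h3 := congrArg (MvPolynomial.coeff (g + Finsupp.single 1 1)) heq
  rw [coeff_monomial_mul_eq_zero (by simp [h2, h10]), MvPolynomial.coeff_sum] at h3
  have h4 : ∀ γ, (tailCoeff c a γ • h γ).coeff (g + Finsupp.single 1 1) =
      if γ = g then tailCoeff c a γ else 0 := by
    intro γ
    by_cases hγ : tailCoeff c a γ = 0
    · simp [hγ]
    · rw [MvPolynomial.coeff_smul, (hspec γ (hcoef γ hγ).1 (hcoef γ hγ).2).2]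
      simp
  rw [Finset.sum_congr rfl fun γ _ => h4 γ, Finset.sum_ite_eq', if_pos] at h3
  · rw [← h3]
    exact (tailCoeff_param c ⟨(a, g), hap⟩).symm
  · simpa [Finset.mem_finsuppAntidiag, Finsupp.degree_eq_sum] using hap.2.2

end Transfer

/-! ### The superminimals determine a marked basis -/

section Superminimals

variable {K : Type u} [Field K] {n : ℕ} {J : Ideal (MvPolynomial (Fin (n + 1)) K)}
  {A : Type*} [CommRing A] {m : ℤ}

/-- Up to multiplication by a power of `x_0`, the polynomial `f` has a normal form with
coefficients in the subring `S`. -/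
def HasNormalFormIn (c : Param (truncation J m) → A) (S : Subring A)
    (f : MvPolynomial (Fin (n + 1)) A) : Prop :=
  ∃ t : ℕ, ∃ h ∈ normalForms J A, (∀ γ, h.coeff γ ∈ S) ∧
    MvPolynomial.monomial (Finsupp.single 0 t) 1 * f - h ∈ markedSpan c

variable {c : Param (truncation J m) → A} {S : Subring A}

theorem monomial_single_add (s t : ℕ) :
    MvPolynomial.monomial (Finsupp.single (0 : Fin (n + 1)) (s + t)) (1 : A) =
      MvPolynomial.monomial (Finsupp.single 0 s) 1 *
        MvPolynomial.monomial (Finsupp.single 0 t) 1 := by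
  rw [MvPolynomial.monomial_mul, one_mul, Finsupp.single_add]

theorem coeff_monomial_mul_mem {h : MvPolynomial (Fin (n + 1)) A} (hh : ∀ γ, h.coeff γ ∈ S)
    (μ γ : Mon n) : (MvPolynomial.monomial μ 1 * h).coeff γ ∈ S := by
  classical
  rw [MvPolynomial.coeff_monomial_mul', one_mul]
  split_ifs
  · exact hh _
  · exact S.zero_mem

theorem HasNormalFormIn.add (hJ : SaturatedMons J) {f g : MvPolynomial (Fin (n + 1)) A}
    (hf : HasNormalFormIn c S f) (hg : HasNormalFormIn c S g) : HasNormalFormIn c S (f + g) := by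
  obtain ⟨s, h, hN, hS, hmem⟩ := hf
  obtain ⟨t, h', hN', hS', hmem'⟩ := hg
  refine ⟨s + t, MvPolynomial.monomial (Finsupp.single 0 t) 1 * h +
    MvPolynomial.monomial (Finsupp.single 0 s) 1 * h',
    add_mem (monomial_mul_mem_normalForms hJ hN t) (monomial_mul_mem_normalForms hJ hN' s),
    fun γ => ?_, ?_⟩
  · rw [MvPolynomial.coeff_add]
    exact add_mem (coeff_monomial_mul_mem hS _ γ) (coeff_monomial_mul_mem hS' _ γ)
  · have := add_mem
      (Ideal.mul_mem_left _ (MvPolynomial.monomial (Finsupp.single 0 t) 1) hmem)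
      (Ideal.mul_mem_left _ (MvPolynomial.monomial (Finsupp.single 0 s) 1) hmem')
    convert this using 1
    rw [monomial_single_add]
    ring

theorem HasNormalFormIn.smul {f : MvPolynomial (Fin (n + 1)) A}
    (hf : HasNormalFormIn c S f) {a : A} (ha : a ∈ S) : HasNormalFormIn c S (a • f) := by
  obtain ⟨s, h, hN, hS, hmem⟩ := hf
  refine ⟨s, a • h, Submodule.smul_mem _ _ hN, fun γ => ?_, ?_⟩
  · rw [MvPolynomial.coeff_smul]
    exact S.mul_mem ha (hS γ)
  · rw [mul_smul_comm, ← smul_sub, MvPolynomial.smul_eq_C_mul]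
    exact Ideal.mul_mem_left _ _ hmem

theorem hasNormalFormIn_zero : HasNormalFormIn c S 0 :=
  ⟨0, 0, zero_mem _, fun _ => S.zero_mem, by simp⟩

theorem hasNormalFormIn_sum (hJ : SaturatedMons J) {ι : Type*} (s : Finset ι)
    (f : ι → MvPolynomial (Fin (n + 1)) A) (hf : ∀ i ∈ s, HasNormalFormIn c S (f i)) :
    HasNormalFormIn c S (∑ i ∈ s, f i) := by
  classical
  induction s using Finset.induction_on with
  | empty => exact hasNormalFormIn_zero
  | insert a s ha ih =>
    rw [Finset.sum_insert ha]
    exact (hf a (Finset.mem_insert_self a s)).add hJ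
      (ih fun i hi => hf i (Finset.mem_insert_of_mem hi))

theorem HasNormalFormIn.of_monomial_mul {f : MvPolynomial (Fin (n + 1)) A} {k : ℕ}
    (hf : HasNormalFormIn c S (MvPolynomial.monomial (Finsupp.single 0 k) 1 * f)) :
    HasNormalFormIn c S f := by
  obtain ⟨s, h, hN, hS, hmem⟩ := hf
  refine ⟨s + k, h, hN, hS, ?_⟩
  rwa [monomial_single_add, mul_assoc]

theorem HasNormalFormIn.of_sub_mem {f g : MvPolynomial (Fin (n + 1)) A}
    (hg : HasNormalFormIn c S g) (h : f - g ∈ markedSpan c) : HasNormalFormIn c S f := by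
  obtain ⟨s, h', hN, hS, hmem⟩ := hg
  refine ⟨s, h', hN, hS, ?_⟩
  have := add_mem (Ideal.mul_mem_left _ (MvPolynomial.monomial (Finsupp.single 0 s) 1) h) hmem
  rwa [mul_sub, sub_add_sub_cancel] at this

/-- The element of the monomial basis of `J_{≥ m}` obtained from one of the monomial basis of `J`
by multiplication with a power of `x_0`. -/
theorem add_single_zero_mem_basisMons_truncation {β : Mon n} (hβ : β ∈ basisMons J) :
    β + Finsupp.single 0 (m - β.degree).toNat ∈ basisMons (truncation J m) := by
  by_cases hd : m ≤ (β.degree : ℤ)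
  · rw [Int.toNat_of_nonpos (by omega), Finsupp.single_zero, add_zero]
    exact mem_basisMons_truncation_of_mem_basisMons hβ hd
  · refine mem_basisMons_truncation_of_degree_eq (mons_of_le hβ.1 le_self_add) ?_
    rw [map_add, Finsupp.degree_single]
    push_cast
    omega

theorem SaturatedMons.erase_basisMons (hJ : SaturatedMons J) {β : Mon n}
    (hβ : β ∈ basisMons J) (k : ℕ) : (β + Finsupp.single 0 k).erase 0 = β := by
  have h0 := hJ.basisMons_apply_zero hβ
  ext i
  by_cases hi : i = 0
  · simp [hi, h0]
  · simp [hi]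

/-- Star decompositions are taken in `J`, not in `J_{≥ m}`: their heads become superminimal after
multiplication by a power of `x_0`, so a step uses only coefficients in `S`. The tail monomials lie
outside `J`, so cofactors decrease as before. -/
theorem hasNormalFormIn_monomial (hS : StableMons J) (hJ : SaturatedMons J)
    (hc : ∀ p : Param (truncation J m), p.1.1 ∈ superminimals (truncation J m) → c p ∈ S)
    (D : Colex (Mon n)) (μ : Mon n) (hD : ∀ δ α, IsStar J δ α → δ + α = μ → toColex δ < D) :
    HasNormalFormIn c S (MvPolynomial.monomial μ 1) := by
  induction D using WellFoundedLT.induction generalizing μ with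
  | ind D ih =>
  by_cases hμ : μ ∈ mons J
  · obtain ⟨δ, β, hs, rfl⟩ := exists_isStar hS μ hμ
    have hδ := hD δ β hs rfl
    -- Truncation to zero covers `|β| ≥ m`, where `x^β` is already a generator of `J_{≥ m}`.
    set k := (m - β.degree).toNat with hk
    have ha : β + Finsupp.single 0 k ∈ basisMons (truncation J m) :=
      add_single_zero_mem_basisMons_truncation hs.1
    have hsm : β + Finsupp.single 0 k ∈ superminimals (truncation J m) := by
      rw [hJ.mem_superminimals_truncation, hJ.erase_basisMons hs.1]
      exact ⟨ha, hs.1⟩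
    refine HasNormalFormIn.of_monomial_mul (k := k) ?_
    refine HasNormalFormIn.of_sub_mem
      (g := MvPolynomial.monomial δ 1 * markedTail c (β + Finsupp.single 0 k)) ?_ ?_
    · rw [monomial_mul_markedTail]
      refine hasNormalFormIn_sum hJ _ _ fun γ _ => ?_
      by_cases hγ : β + Finsupp.single 0 k ∈ basisMons (truncation J m) ∧
          γ ∉ mons (truncation J m) ∧ γ.degree = (β + Finsupp.single 0 k).degree
      · have hγJ : γ ∉ mons J := param_tail_notMem (⟨(_, γ), hγ⟩ : Param (truncation J m))
        refine HasNormalFormIn.smul (ih (toColex δ) hδ (δ + γ) fun δ' α' hs' hadd =>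
          hs'.toColex_lt hadd.symm fun hle => hγJ (mons_of_le hs'.1.1 hle)) ?_
        rw [tailCoeff, dif_pos hγ]
        exact hc _ hsm
      · rw [tailCoeff, dif_neg hγ, zero_smul]
        exact hasNormalFormIn_zero
    · have h1 := Ideal.mul_mem_left _ (MvPolynomial.monomial δ 1)
        (markedPoly_mem_markedSpan c ha)
      rw [markedPoly, mul_sub, MvPolynomial.monomial_mul, one_mul] at h1
      rw [MvPolynomial.monomial_mul, one_mul]
      have hexp : Finsupp.single 0 k + (δ + β) = δ + (β + Finsupp.single 0 k) := by abel
      rwa [hexp]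
  · exact ⟨0, MvPolynomial.monomial μ 1, monomial_mem_normalForms hμ 1, fun γ => by
      classical
      rw [MvPolynomial.coeff_monomial]
      split_ifs
      · exact S.one_mem
      · exact S.zero_mem, by simp⟩

/-- The coefficients of a marked basis belong to every subring that contains the coefficients of
the superminimals. -/
theorem IsMarkedBasis.apply_mem (hS : StableMons J) (hJ : SaturatedMons J) (hb : IsMarkedBasis c)
    (hc : ∀ p : Param (truncation J m), p.1.1 ∈ superminimals (truncation J m) → c p ∈ S)
    (p : Param (truncation J m)) : c p ∈ S := by
  obtain ⟨D, hD⟩ := exists_toColex_lt (J := J) p.1.1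
  obtain ⟨t, h, hN, hcoef, hmem⟩ := hasNormalFormIn_monomial hS hJ hc D p.1.1 hD
  have h1 := Ideal.mul_mem_left _ (MvPolynomial.monomial (Finsupp.single 0 t) 1)
    (markedPoly_mem_markedSpan c p.2.1)
  rw [markedPoly, mul_sub] at h1
  -- The coefficients of the tail are those of `x_0^t` times it, and by uniqueness this product is
  -- the normal form with coefficients in `S`.
  have h2 := hb.normalForm_unique hN
    (monomial_mul_mem_normalForms hJ (markedTail_mem c p.1.1) t) hmem h1
  have h3 := hcoef (Finsupp.single 0 t + p.1.2)
  rwa [h2, MvPolynomial.coeff_monomial_mul, one_mul, coeff_markedTail, tailCoeff_param] at h3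

end Superminimals

/-! ### Coordinate rings of marked schemes -/

section CoordinateRings

variable {K : Type u} [Field K] {n : ℕ} {J : Ideal (MvPolynomial (Fin (n + 1)) K)}
  {A : Type*} [CommRing A] [Algebra K A] {m : ℤ}

variable (J) in
/-- The coordinate ring of the marked scheme. -/
abbrev MfRing : Type u := MvPolynomial (Param J) K ⧸ markedIdeal J

variable (J) in
/-- The coefficients of the universal marked basis. -/
def universalCoeffs (p : Param J) : MfRing J :=
  Ideal.Quotient.mkₐ K (markedIdeal J) (MvPolynomial.X p)

theorem isMarkedBasis_universalCoeffs (hS : StableMons J) : IsMarkedBasis (universalCoeffs J) :=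
  (markedIdeal_le_ker_iff hS (Ideal.Quotient.mkₐ K (markedIdeal J)).toRingHom).1 fun _ ha =>
    Ideal.Quotient.eq_zero_iff_mem.2 ha

theorem aeval_eq_zero_of_mem_markedIdeal (hS : StableMons J) {c : Param J → A}
    (hc : IsMarkedBasis c) {a : MvPolynomial (Param J) K} (ha : a ∈ markedIdeal J) :
    MvPolynomial.aeval c a = 0 := by
  refine (markedIdeal_le_ker_iff hS (MvPolynomial.aeval (R := K) c).toRingHom).2 ?_ ha
  have : (fun p => (MvPolynomial.aeval (R := K) c).toRingHom (MvPolynomial.X p)) = c :=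
    funext fun p => MvPolynomial.aeval_X c p
  rwa [this]

/-- The homomorphism on the coordinate ring of the marked scheme that is defined by a marked
basis. -/
def MfRing.lift (hS : StableMons J) (c : Param J → A) (hc : IsMarkedBasis c) : MfRing J →ₐ[K] A :=
  Ideal.Quotient.liftₐ (markedIdeal J) (MvPolynomial.aeval c)
    fun _ ha => aeval_eq_zero_of_mem_markedIdeal hS hc ha

theorem MfRing.lift_universalCoeffs (hS : StableMons J) (c : Param J → A) (hc : IsMarkedBasis c)
    (p : Param J) : MfRing.lift hS c hc (universalCoeffs J p) = c p :=
  (Ideal.Quotient.liftₐ_apply _ _ _ _).trans (MvPolynomial.aeval_X c p)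

theorem MfRing.algHom_ext {f g : MfRing J →ₐ[K] A}
    (h : ∀ p, f (universalCoeffs J p) = g (universalCoeffs J p)) : f = g := by
  refine Ideal.Quotient.algHom_ext K ?_
  exact MvPolynomial.algHom_ext h

theorem isMarkedBasis_of_algHom (hS : StableMons J) (f : MfRing J →ₐ[K] A) :
    IsMarkedBasis fun p => f (universalCoeffs J p) :=
  (markedIdeal_le_ker_iff hS
    (f.comp (Ideal.Quotient.mkₐ K (markedIdeal J))).toRingHom).1 fun a ha => by
      change f (Ideal.Quotient.mk _ a) = 0
      rw [Ideal.Quotient.eq_zero_iff_mem.2 ha, map_zero]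

theorem MfRing.surjective_of_range {f : A →ₐ[K] MfRing J}
    (h : ∀ p, universalCoeffs J p ∈ f.range) : Function.Surjective f := by
  rw [← AlgHom.range_eq_top, eq_top_iff]
  rintro x -
  obtain ⟨a, rfl⟩ := Ideal.Quotient.mk_surjective x
  induction a using MvPolynomial.induction_on with
  | C r => exact f.range.algebraMap_mem r
  | add a b ha hb => rw [map_add]; exact add_mem ha hb
  | mul_X a p ha => rw [map_mul]; exact mul_mem ha (h p)

variable (hS : StableMons J) (hJ : SaturatedMons J)

/-- The homomorphism of coordinate rings `K[Mf(J_{≥ m})] → K[Mf(J_{≥ m-1})]`. -/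
def truncationHom (m : ℤ) : MfRing (truncation J m) →ₐ[K] MfRing (truncation J (m - 1)) :=
  MfRing.lift (hS.truncation m) (truncateCoeffs hS m (universalCoeffs (truncation J (m - 1))))
    (isMarkedBasis_of_markedPoly_mem (isMarkedBasis_universalCoeffs (hS.truncation (m - 1)))
      fun _ hα => markedPoly_truncateCoeffs_mem hS _ hα)

theorem markedPoly_truncationHom_mem {α : Mon n} (hα : α ∈ basisMons (truncation J m)) :
    markedPoly (fun p => truncationHom hS m (universalCoeffs (truncation J m) p)) α ∈
      markedSpan (universalCoeffs (truncation J (m - 1))) := by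
  simp only [truncationHom, MfRing.lift_universalCoeffs]
  exact markedPoly_truncateCoeffs_mem hS _ hα

theorem truncationHom_shiftParam (p : Param (truncation J (m - 1))) :
    truncationHom hS m (universalCoeffs _ (shiftParam hJ m p)) = universalCoeffs _ p :=
  apply_shiftParam hJ (isMarkedBasis_universalCoeffs (hS.truncation (m - 1)))
    (c₁ := fun p => truncationHom hS m (universalCoeffs (truncation J m) p))
    (fun _ hα => markedPoly_truncationHom_mem hS hα) p

include hJ in
theorem truncationHom_cutParams {p : Param (truncation J m)} (hp : p ∈ cutParams J m) :
    truncationHom hS m (universalCoeffs _ p) = 0 :=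
  apply_cutParams hJ (isMarkedBasis_universalCoeffs (hS.truncation (m - 1)))
    (c₁ := fun p => truncationHom hS m (universalCoeffs (truncation J m) p))
    (fun _ hα => markedPoly_truncationHom_mem hS hα) hp

include hJ in
theorem truncationHom_surjective : Function.Surjective (truncationHom hS m) :=
  MfRing.surjective_of_range fun p => ⟨_, truncationHom_shiftParam hS hJ p⟩

include hJ in
/-- A homomorphism that kills the parameters in `cutParams J m` factors through `truncationHom`. -/
theorem exists_comp_truncationHom_eq (g : MfRing (truncation J m) →ₐ[K] A)
    (hg : ∀ p ∈ cutParams J m, g (universalCoeffs _ p) = 0) :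
    ∃ f : MfRing (truncation J (m - 1)) →ₐ[K] A, f.comp (truncationHom hS m) = g := by
  have hc := isMarkedBasis_of_algHom (hS.truncation m) g
  have hc' := isMarkedBasis_shift hJ hc hg
  let f := MfRing.lift (hS.truncation (m - 1)) _ hc'
  refine ⟨f, MfRing.algHom_ext fun p => ?_⟩
  have h1 := map_mem_markedSpan f.toRingHom _ (markedPoly_truncationHom_mem hS p.2.1)
  rw [map_markedPoly] at h1
  have h2 : (fun q => f.toRingHom (universalCoeffs (truncation J (m - 1)) q)) =
      fun q => g (universalCoeffs _ (shiftParam hJ m q)) :=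
    funext fun q => MfRing.lift_universalCoeffs _ _ _ q
  rw [h2] at h1
  have h3 := hc'.normalForm_unique (markedTail_mem _ p.1.1) (markedTail_mem _ p.1.1) h1
    (markedPoly_mem_markedSpan_shift hJ hS hc hg p.2.1)
  have h4 := congrArg (MvPolynomial.coeff p.1.2) h3
  rwa [coeff_markedTail, coeff_markedTail, tailCoeff_param, tailCoeff_param] at h4

include hJ in
theorem truncationHom_bijective_of_cutParams
    (h : ∀ p ∈ cutParams J m, universalCoeffs (truncation J m) p = 0) :
    Function.Bijective (truncationHom hS m) := by
  refine ⟨?_, truncationHom_surjective hS hJ⟩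
  -- The identity kills the cut parameters, so it factors through `truncationHom`; the factor is a
  -- left inverse.
  obtain ⟨f, hf⟩ := exists_comp_truncationHom_eq hS hJ (AlgHom.id K (MfRing (truncation J m))) h
  exact Function.LeftInverse.injective (g := f) fun x => DFunLike.congr_fun hf x

include hJ in
theorem truncationHom_bijective
    (h : truncation J (m - 1) = truncation J m ∨
      ∀ α ∈ basisMons J, (α.degree : ℤ) = m + 1 → α 1 = 0) :
    Function.Bijective (truncationHom hS m) := by
  refine truncationHom_bijective_of_cutParams hS hJ fun p hp => ?_
  rcases h with h | h
  · obtain ⟨α, hα, hd, -⟩ := hp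
    have h1 : α ∈ mons (truncation J (m - 1)) := mem_mons_truncation.2 ⟨hα, hd.ge⟩
    rw [h] at h1
    have := (mem_mons_truncation.1 h1).2
    omega
  · exact apply_cutParams_eq_zero hS hJ h (isMarkedBasis_universalCoeffs (hS.truncation m)) hp

include hS hJ in
theorem superminimalHom_surjective (m : ℤ) :
    Function.Surjective ((Ideal.Quotient.mkₐ K (markedIdeal (truncation J m))).comp
      (MvPolynomial.rename (Subtype.val : SParam (truncation J m) → Param (truncation J m)))) :=
  MfRing.surjective_of_range fun p =>
    (isMarkedBasis_universalCoeffs (hS.truncation m)).apply_mem hS hJ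
      -- The subring to test is the image itself, which contains the superminimal coefficients.
      (S := (AlgHom.range _).toSubring)
      (fun q hq => ⟨MvPolynomial.X (⟨q, hq⟩ : SParam (truncation J m)), by
        simp [universalCoeffs]⟩) p

end CoordinateRings

/-! ### Tangent spaces -/

section Tangent

variable {K : Type u} [Field K] {n : ℕ} {J : Ideal (MvPolynomial (Fin (n + 1)) K)} {m : ℤ}

theorem linearPart_eq_sum {σ : Type} [Fintype σ] (f : MvPolynomial σ K) (v : σ → K) :
    linearPart f v = ∑ i, f.coeff (Finsupp.single i 1) * v i := by
  classical
  rw [linearPart, LinearMap.sum_apply]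
  refine Finset.sum_subset (Finset.subset_univ _) fun i _ hi => ?_
  have : f.coeff (Finsupp.single i 1) = 0 := by
    by_contra h
    exact hi ((MvPolynomial.mem_vars_iff_mem_support i).2
      ⟨_, MvPolynomial.mem_support_iff.2 h, by simp⟩)
  simp [this]

/-- First-order Taylor expansion at the origin, linking tangent vectors to points over the dual
numbers. -/
theorem aeval_inr {σ : Type} [Fintype σ] (f : MvPolynomial σ K) (v : σ → K) :
    MvPolynomial.aeval (fun i => (TrivSqZeroExt.inr (v i) : TrivSqZeroExt K K)) f =
      TrivSqZeroExt.inl (f.coeff 0) + TrivSqZeroExt.inr (linearPart f v) := by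
  classical
  simp only [linearPart_eq_sum]
  induction f using MvPolynomial.induction_on with
  | C a =>
    have h : ∀ i : σ, (0 : σ →₀ ℕ) ≠ Finsupp.single i 1 := fun i h => by
      simpa using DFunLike.congr_fun h i
    simp [MvPolynomial.coeff_C, h, TrivSqZeroExt.algebraMap_eq_inl]
  | add p q hp hq =>
    rw [map_add, hp, hq]
    ext <;> simp [add_mul, Finset.sum_add_distrib]
  | mul_X p j hp =>
    rw [map_mul, hp, MvPolynomial.aeval_X]
    have h : ∀ i, (p * MvPolynomial.X j).coeff (Finsupp.single i 1) =
        if i = j then p.coeff 0 else 0 := by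
      intro i
      rw [MvPolynomial.coeff_mul_X']
      by_cases hij : i = j
      · subst hij; simp
      · simp [hij, Ne.symm hij]
    have h0 : (p * MvPolynomial.X j).coeff 0 = 0 := by simp [MvPolynomial.coeff_mul_X']
    ext <;> simp [h, h0, mul_comm]

theorem mem_tangentAtOrigin {σ : Type} {a : Ideal (MvPolynomial σ K)} {v : σ → K} :
    v ∈ tangentAtOrigin a ↔ ∀ f ∈ a, linearPart f v = 0 := by
  simp [tangentAtOrigin, Submodule.mem_iInf]

theorem markedTail_zero {A : Type*} [CommRing A] (α : Mon n) :
    markedTail (fun _ : Param J => (0 : A)) α = 0 := by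
  ext γ
  rw [coeff_markedTail, tailCoeff]
  simp

theorem isMarkedBasis_zero : IsMarkedBasis (fun _ : Param J => (0 : K)) := by
  intro h hh hN
  have h1 : markedPoly (fun _ : Param J => (0 : K)) = fun α => MvPolynomial.monomial α 1 :=
    funext fun α => by rw [markedPoly, markedTail_zero, sub_zero]
  rw [markedSpan, h1, MvPolynomial.mem_ideal_span_monomial_image] at hh
  ext γ
  by_contra hne
  obtain ⟨α, hα, hle⟩ := hh γ (MvPolynomial.mem_support_iff.2 hne)
  exact hne (hN γ (mons_of_le hα.1 hle))

theorem coeff_zero_of_mem_markedIdeal (hS : StableMons J) {f : MvPolynomial (Param J) K}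
    (hf : f ∈ markedIdeal J) : f.coeff 0 = 0 := by
  have := aeval_eq_zero_of_mem_markedIdeal hS isMarkedBasis_zero hf
  rwa [MvPolynomial.aeval_zero', Algebra.algebraMap_self_apply] at this

/-- The tangent vectors at the origin are the marked bases over the dual numbers that specialize to
the monomial one. -/
theorem mem_tangentAtOrigin_markedIdeal_iff (hS : StableMons J) {v : Param J → K} :
    v ∈ tangentAtOrigin (markedIdeal J) ↔
      IsMarkedBasis fun p => (TrivSqZeroExt.inr (v p) : TrivSqZeroExt K K) := by
  have := Fintype.ofFinite (Param J)
  rw [mem_tangentAtOrigin]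
  constructor
  · intro hv
    have h1 := (markedIdeal_le_ker_iff hS (MvPolynomial.aeval (R := K) fun p : Param J =>
      (TrivSqZeroExt.inr (v p) : TrivSqZeroExt K K)).toRingHom).1 fun f hf => by
        change MvPolynomial.aeval _ f = 0
        rw [aeval_inr, hv f hf, coeff_zero_of_mem_markedIdeal hS hf]
        simp
    have h2 : (fun p => (MvPolynomial.aeval (R := K) fun p : Param J =>
        (TrivSqZeroExt.inr (v p) : TrivSqZeroExt K K)).toRingHom (MvPolynomial.X p)) =
        fun p => TrivSqZeroExt.inr (v p) := funext fun p => MvPolynomial.aeval_X _ p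
    rwa [h2] at h1
  · intro hv f hf
    have h1 := aeval_eq_zero_of_mem_markedIdeal hS hv hf
    rw [aeval_inr] at h1
    simpa using congrArg TrivSqZeroExt.snd h1

/-- The tangent vectors of `Mf(J_{≥ m})` along which the parameters in `cutParams J m` vanish. -/
def cutTangent (J : Ideal (MvPolynomial (Fin (n + 1)) K)) (m : ℤ) :
    Submodule K (Param (truncation J m) → K) :=
  tangentAtOrigin (markedIdeal (truncation J m)) ⊓
    ⨅ p ∈ cutParams J m, LinearMap.ker (LinearMap.proj p)

theorem mem_cutTangent {v : Param (truncation J m) → K} :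
    v ∈ cutTangent J m ↔ v ∈ tangentAtOrigin (markedIdeal (truncation J m)) ∧
      ∀ p ∈ cutParams J m, v p = 0 := by
  simp [cutTangent, Submodule.mem_iInf]

theorem shift_mem_tangentAtOrigin (hS : StableMons J) (hJ : SaturatedMons J)
    {v : Param (truncation J m) → K} (hv : v ∈ cutTangent J m) :
    (fun p => v (shiftParam hJ m p)) ∈
      tangentAtOrigin (markedIdeal (truncation J (m - 1))) := by
  rw [mem_cutTangent, mem_tangentAtOrigin_markedIdeal_iff (hS.truncation m)] at hv
  rw [mem_tangentAtOrigin_markedIdeal_iff (hS.truncation (m - 1))]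
  exact isMarkedBasis_shift hJ (c := fun p => (TrivSqZeroExt.inr (v p) : TrivSqZeroExt K K)) hv.1
    fun p hp => by rw [hv.2 p hp, TrivSqZeroExt.inr_zero]

theorem exists_mem_cutTangent (hS : StableMons J) (hJ : SaturatedMons J)
    {v : Param (truncation J (m - 1)) → K}
    (hv : v ∈ tangentAtOrigin (markedIdeal (truncation J (m - 1)))) :
    ∃ w ∈ cutTangent J m, (fun p => w (shiftParam hJ m p)) = v := by
  rw [mem_tangentAtOrigin_markedIdeal_iff (hS.truncation (m - 1))] at hv
  set c₁ := truncateCoeffs hS m fun p => (TrivSqZeroExt.inr (v p) : TrivSqZeroExt K K)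
  have hmem : ∀ α ∈ basisMons (truncation J m), markedPoly c₁ α ∈ markedSpan _ :=
    fun α hα => markedPoly_truncateCoeffs_mem hS _ hα
  have hb : IsMarkedBasis c₁ := isMarkedBasis_of_markedPoly_mem hv hmem
  -- Setting `ε = 0` specializes to the monomial marked basis, modulo which each generator has
  -- normal form zero. So the induced coefficients are pure multiples of `ε`.
  have hfst : ∀ p, (c₁ p).fst = 0 := by
    intro p
    have h1 : markedPoly (fun p => (c₁ p).fst) p.1.1 ∈
        markedSpan (fun _ : Param (truncation J (m - 1)) => (0 : K)) := by
      have h1 := map_mem_markedSpan (TrivSqZeroExt.fstHom K K K).toRingHom _ (hmem _ p.2.1)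
      rw [map_markedPoly] at h1
      have h2 : (fun p => (TrivSqZeroExt.fstHom K K K).toRingHom (TrivSqZeroExt.inr (v p))) =
          fun _ => 0 := funext fun p => TrivSqZeroExt.fst_inr K (v p)
      rw [h2] at h1
      exact h1
    have hp := mem_mons_truncation.1 p.2.1.1
    obtain ⟨β, hβ, hle⟩ := exists_basisMons_le (mem_mons_truncation.2
      ⟨hp.1, by omega⟩ : p.1.1 ∈ mons (truncation J (m - 1)))
    have h3 := Ideal.mul_mem_left _ (MvPolynomial.monomial (p.1.1 - β) 1)
      (markedPoly_mem_markedSpan (fun _ : Param (truncation J (m - 1)) => (0 : K)) hβ)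
    rw [markedPoly, markedTail_zero, sub_zero, MvPolynomial.monomial_mul, one_mul,
      tsub_add_cancel_of_le hle, ← sub_zero (MvPolynomial.monomial p.1.1 1)] at h3
    have h4 := isMarkedBasis_zero.normalForm_unique (markedTail_mem _ p.1.1) (zero_mem _) h1 h3
    have h5 := congrArg (MvPolynomial.coeff p.1.2) h4
    rw [coeff_markedTail, tailCoeff_param, MvPolynomial.coeff_zero] at h5
    exact h5
  have hc : ∀ p, c₁ p = TrivSqZeroExt.inr (c₁ p).snd := fun p => by
    ext
    · rw [hfst, TrivSqZeroExt.fst_inr]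
    · rw [TrivSqZeroExt.snd_inr]
  refine ⟨fun p => (c₁ p).snd, mem_cutTangent.2 ⟨?_, fun p hp => ?_⟩, funext fun p => ?_⟩
  · rw [mem_tangentAtOrigin_markedIdeal_iff (hS.truncation m)]
    convert hb using 2 with p
    exact (hc p).symm
  · rw [apply_cutParams hJ hv hmem hp, TrivSqZeroExt.snd_zero]
  · exact (congrArg TrivSqZeroExt.snd (apply_shiftParam hJ hv hmem p)).trans
      (TrivSqZeroExt.snd_inr K (v p))

theorem rank_tangent_le_rank_cutTangent (hS : StableMons J) (hJ : SaturatedMons J) (m : ℤ) :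
    Module.rank K (tangentAtOrigin (markedIdeal (truncation J (m - 1)))) ≤
      Module.rank K (cutTangent J m) := by
  let L : cutTangent J m →ₗ[K] tangentAtOrigin (markedIdeal (truncation J (m - 1))) :=
    ((LinearMap.funLeft K K (shiftParam hJ m)).comp (cutTangent J m).subtype).codRestrict _
      fun v => shift_mem_tangentAtOrigin hS hJ v.2
  refine LinearMap.rank_le_of_surjective L fun v => ?_
  obtain ⟨w, hw, hwv⟩ := exists_mem_cutTangent hS hJ v.2
  exact ⟨⟨w, hw⟩, Subtype.ext hwv⟩

end Tangent

/-! ### First-order deformations of a single generator -/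

section SpecialTangent

variable {K : Type u} [Field K] {n : ℕ} {J : Ideal (MvPolynomial (Fin (n + 1)) K)} {m : ℤ}
  {A : Type*} [CommRing A]

open Classical in
/-- The linear map that fixes the monomials outside `J`, sends `x_0^d x^α`, when divisible by
`x^h`, to `ε x_0^d x^α x^g / x^h`, and kills the other monomials of `J`. -/
def deformation (J : Ideal (MvPolynomial (Fin (n + 1)) K)) (α h g : Mon n) (ε : A) :
    MvPolynomial (Fin (n + 1)) A →ₗ[A] MvPolynomial (Fin (n + 1)) A :=
  (MvPolynomial.basisMonomials (Fin (n + 1)) A).constr A fun μ : Mon n =>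
    if μ ∉ mons J then MvPolynomial.monomial μ 1
    else if h ≤ μ ∧ μ.erase 0 = α then MvPolynomial.monomial (μ - h + g) ε else 0

open Classical in
theorem deformation_monomial (α h g μ : Mon n) (ε : A) :
    deformation J α h g ε (MvPolynomial.monomial μ 1) =
      if μ ∉ mons J then MvPolynomial.monomial μ 1
      else if h ≤ μ ∧ μ.erase 0 = α then MvPolynomial.monomial (μ - h + g) ε else 0 := by
  have := (MvPolynomial.basisMonomials (Fin (n + 1)) A).constr_basis A (fun μ : Mon n =>
    if μ ∉ mons J then MvPolynomial.monomial μ (1 : A)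
    else if h ≤ μ ∧ μ.erase 0 = α then MvPolynomial.monomial (μ - h + g) ε else 0) μ
  rwa [MvPolynomial.coe_basisMonomials] at this

theorem deformation_normalForm (α h g : Mon n) (ε : A) {f : MvPolynomial (Fin (n + 1)) A}
    (hf : f ∈ normalForms J A) : deformation J α h g ε f = f := by
  conv_rhs => rw [f.as_sum]
  conv_lhs => rw [f.as_sum]
  rw [map_sum]
  refine Finset.sum_congr rfl fun μ hμ => ?_
  rw [monomial_eq_smul, map_smul, deformation_monomial, if_pos]
  exact fun h => MvPolynomial.mem_support_iff.1 hμ (hf μ h)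

open Classical in
/-- The deformation of the monomial basis along a single parameter. -/
theorem isMarkedBasis_single (hJ : SaturatedMons J)
    {ε : A} (hε : ε * ε = 0) {α g : Mon n} (hα : α ∈ basisMons J)
    (hg : g ∉ mons J) (hg' : ∀ i, i ≠ 0 → g + Finsupp.single i 1 ∈ mons J)
    {z : Param (truncation J m)}
    (hz : z.1 = (α + Finsupp.single 0 (m - α.degree).toNat, g)) :
    IsMarkedBasis fun p : Param (truncation J m) => if p = z then ε else 0 := by
  set k := (m - α.degree).toNat with hk
  set h := α + Finsupp.single 0 k with hh
  set c : Param (truncation J m) → A := fun p => if p = z then ε else 0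
  have hB : h ∈ basisMons (truncation J m) := add_single_zero_mem_basisMons_truncation hα
  have herase : ∀ δ : Mon n, (δ + h).erase 0 = δ.erase 0 + α := fun δ => by
    rw [Finsupp.erase_add, hh, hJ.erase_basisMons hα]
  have htail : ∀ a, markedTail c a = if a = h then MvPolynomial.monomial g ε else 0 := by
    intro a
    ext γ
    rw [coeff_markedTail]
    by_cases hγ : (a, γ) = z.1
    · have hz' := tailCoeff_param c z
      rw [hz] at hγ hz'
      obtain ⟨rfl, rfl⟩ := Prod.mk.inj hγ
      rw [if_pos rfl, MvPolynomial.coeff_monomial, if_pos rfl]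
      simpa [c] using hz'
    · have h0 : tailCoeff c a γ = 0 := by
        rw [tailCoeff]
        split_ifs with h1
        · exact if_neg fun h2 => hγ (congrArg Subtype.val h2)
        · rfl
      rw [h0]
      split_ifs with h1
      · rw [MvPolynomial.coeff_monomial, if_neg]
        rintro rfl
        exact hγ (by rw [hz, h1])
      · simp
  -- For the deformed generator: if `x^δ` is a power of `x_0`, head and tail have the same image.
  -- Otherwise the head is killed and `x^δ x^g ∈ J`, so the tail contributes zero or a multiple of
  -- `ε²`. Heads of the other generators are killed outright.
  have hker : ∀ a ∈ basisMons (truncation J m), ∀ δ : Mon n,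
      deformation J α h g ε (MvPolynomial.monomial δ 1 * markedPoly c a) = 0 := by
    intro a ha δ
    have haJ := mem_mons_truncation.1 ha.1
    rw [markedPoly, mul_sub, MvPolynomial.monomial_mul, one_mul, htail, map_sub,
      deformation_monomial, if_neg (not_not.2 (mons_add haJ.1 δ))]
    by_cases hah : a = h
    · subst hah
      rw [if_pos rfl, MvPolynomial.monomial_mul, one_mul, monomial_eq_smul (δ + g), map_smul,
        deformation_monomial, herase]
      by_cases hδ : δ.erase 0 = 0
      · have h1 : δ = Finsupp.single 0 (δ 0) := by
          conv_lhs => rw [← Finsupp.erase_add_single 0 δ, hδ, zero_add]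
        rw [if_pos ⟨le_add_self, by rw [hδ, zero_add]⟩, if_pos, add_tsub_cancel_right,
          ← monomial_eq_smul, sub_self]
        rw [h1, add_comm (Finsupp.single 0 (δ 0))]
        exact fun h2 => hg (hJ.of_add_single h2)
      · have h1 : δ + g ∈ mons J := by
          obtain ⟨i, hi⟩ := DFunLike.ne_iff.1 hδ
          have hi0 : i ≠ 0 := by
            rintro rfl
            simp at hi
          rw [Finsupp.erase_ne hi0] at hi
          refine mons_of_le (hg' i hi0) ?_
          rw [add_comm δ]
          exact add_le_add_right (Finsupp.single_le_iff.2 (Nat.one_le_iff_ne_zero.2 hi)) g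
        rw [if_neg, if_neg (not_not.2 h1), zero_sub, neg_eq_zero]
        · split_ifs
          · rw [MvPolynomial.smul_monomial, smul_eq_mul, hε, MvPolynomial.monomial_zero]
          · rw [smul_zero]
        · exact fun h2 => hδ (add_eq_right.1 h2.2)
    · rw [if_neg hah, mul_zero, map_zero, sub_zero, if_neg]
      rintro ⟨-, h2⟩
      -- If such a head were not killed, `x^a` would be `x^α` times a power of `x_0`. Its degree is
      -- at least `m`, so it would be a multiple of `x^h`, hence equal to it by minimality.
      have h3 : a.erase 0 = α := by
        refine hα.2 _ (hJ.erase_mem haJ.1) ?_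
        rw [← h2, Finsupp.erase_add]
        exact le_add_self
      have h4 : a = α + Finsupp.single 0 (a 0) := by
        conv_lhs => rw [← Finsupp.erase_add_single 0 a, h3]
      have h5 := congrArg Finsupp.degree h4
      rw [map_add, Finsupp.degree_single] at h5
      refine hah (ha.2 h hB.1 ?_).symm
      rw [h4, hh]
      refine add_le_add_right (Finsupp.single_le_single.2 ?_) α
      omega
  rw [isMarkedBasis_truncation_iff]
  intro f hf hN
  rw [← deformation_normalForm α h g ε hN]
  -- The map is only `A`-linear, so induction over the ideal needs all multiples at once.
  suffices hp : ∀ p, deformation J α h g ε (p * f) = 0 by simpa using hp 1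
  clear hN
  induction hf using Submodule.span_induction with
  | mem x hx =>
    obtain ⟨a, ha, rfl⟩ := hx
    intro p
    rw [p.as_sum, Finset.sum_mul, map_sum]
    refine Finset.sum_eq_zero fun δ _ => ?_
    rw [monomial_eq_smul, smul_mul_assoc, map_smul, hker a ha, smul_zero]
  | zero => simp
  | add x y _ _ hx hy =>
    intro p
    rw [mul_add, map_add, hx, hy, add_zero]
  | smul a x _ hx =>
    intro p
    rw [smul_eq_mul, ← mul_assoc]
    exact hx _

variable (J) in
/-- The pairs of a monomial of degree `m + 1` in the basis of `J` that is divisible by `x_1` and a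
monomial of degree at most `m - 1` in the basis of `J`. -/
abbrev TangentIndex (m : ℤ) : Type :=
  {β | β ∈ basisMons J ∧ (β.degree : ℤ) = m + 1 ∧ β 1 ≠ 0} ×
    {α | α ∈ basisMons J ∧ (α.degree : ℤ) ≤ m - 1}

theorem one_ne_zero_of_index (hJ : SaturatedMons J) {β : Mon n} (hβ : β ∈ basisMons J)
    (h1 : β 1 ≠ 0) : (1 : Fin (n + 1)) ≠ 0 := fun h =>
  h1 (by rw [h]; exact hJ.basisMons_apply_zero hβ)

/-- The parameter with head `x_0^k x^α` and tail monomial `x^β / x_1`. -/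
def tangentParam (q : TangentIndex J m) : Param (truncation J m) :=
  ⟨(q.2.1 + Finsupp.single 0 (m - q.2.1.degree).toNat, q.1.1 - Finsupp.single 1 1),
    add_single_zero_mem_basisMons_truncation q.2.2.1, fun h => by
      have h1 := sub_single_add_single q.1.2.2.2
      have h2 := q.1.2.1
      rw [← h1] at h2
      exact add_single_notMem_basisMons (mem_mons_truncation.1 h).1 1 h2, by
      have h1 := congrArg Finsupp.degree (sub_single_add_single q.1.2.2.2)
      have h2 := q.1.2.2.1
      have h3 := q.2.2.2
      rw [map_add, Finsupp.degree_single] at h1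
      rw [map_add, Finsupp.degree_single]
      simp only
      omega⟩

/-- The bound `|α| ≤ m - 1` leaves at least one factor `x_0` in the head, while `x^β`, a generator
of a saturated ideal, contains none. -/
theorem tangentParam_mem_cutParams (hJ : SaturatedMons J) (q : TangentIndex J m) :
    tangentParam q ∈ cutParams J m := by
  obtain ⟨⟨β, hβ⟩, ⟨α, hα⟩⟩ := q
  obtain ⟨k, hk⟩ : ∃ k, (m - α.degree).toNat = k + 1 :=
    Nat.exists_eq_succ_of_ne_zero (by have := hα.2; omega)
  refine ⟨α + Finsupp.single 0 k, mons_of_le hα.1.1 le_self_add, ?_, ?_, ?_⟩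
  · have := hα.2
    rw [map_add, Finsupp.degree_single]
    push_cast
    omega
  · rw [add_assoc, ← Finsupp.single_add, ← hk]
    rfl
  · have h0 := hJ.basisMons_apply_zero hβ.1
    simp [tangentParam, h0]

theorem tangentParam_injective (hJ : SaturatedMons J) :
    Function.Injective (tangentParam (J := J) (m := m)) := by
  rintro ⟨⟨β, hβ⟩, ⟨α, hα⟩⟩ ⟨⟨β', hβ'⟩, ⟨α', hα'⟩⟩ h
  have h1 := congrArg Subtype.val h
  obtain ⟨h2, h3⟩ := Prod.mk.inj h1
  have h4 := congrArg (Finsupp.erase 0) h2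
  simp only [hJ.erase_basisMons hα.1, hJ.erase_basisMons hα'.1] at h4
  have h5 : β = β' := by
    rw [← sub_single_add_single hβ.2.2, ← sub_single_add_single hβ'.2.2, h3]
  simp only [h4, h5]

open Classical in
theorem isMarkedBasis_tangentParam (hS : StableMons J) (hJ : SaturatedMons J)
    {ε : A} (hε : ε * ε = 0) (q : TangentIndex J m) :
    IsMarkedBasis fun p : Param (truncation J m) => if p = tangentParam q then ε else 0 := by
  have h1 := sub_single_add_single q.1.2.2.2
  have h10 := one_ne_zero_of_index hJ q.1.2.1 q.1.2.2.2
  refine isMarkedBasis_single hJ hε q.2.2.1 (param_tail_notMem (tangentParam q))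
    (fun i hi => ?_) rfl
  change q.1.1 - Finsupp.single 1 1 + Finsupp.single i 1 ∈ mons J
  -- For `i = 1` the product is `x^β` again; for `i > 1` it comes from `x^β` by trading `x_1` for
  -- `x_i`.
  by_cases hi1 : i = 1
  · rw [hi1, h1]
    exact q.1.2.1.1
  · refine hS q.1.1 _ ⟨1, i, ?_, ?_⟩ q.1.2.1.1
    · have h3 : (1 : Fin (n + 1)).val = 1 := by
        have h4 := (1 : Fin (n + 1)).isLt
        rw [Fin.val_one']
        refine Nat.mod_eq_of_lt ?_
        by_contra h5
        have : n = 0 := by omega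
        subst this
        exact h10 rfl
      rw [Fin.lt_def, h3]
      have h4 : i.val ≠ 0 := fun h => hi (Fin.ext h)
      have h5 : i.val ≠ 1 := fun h => hi1 (Fin.ext (h.trans h3.symm))
      omega
    · rw [add_right_comm, h1]

open Classical in
theorem single_mem_tangentAtOrigin (hS : StableMons J) (hJ : SaturatedMons J)
    (q : TangentIndex J m) :
    Pi.single (tangentParam q) (1 : K) ∈ tangentAtOrigin (markedIdeal (truncation J m)) := by
  rw [mem_tangentAtOrigin_markedIdeal_iff (hS.truncation m)]
  convert isMarkedBasis_tangentParam hS hJ (A := TrivSqZeroExt K K)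
    (ε := TrivSqZeroExt.inr 1) (TrivSqZeroExt.inr_mul_inr K 1 1) q using 2 with p
  rw [Pi.single_apply]
  split_ifs
  · rfl
  · exact TrivSqZeroExt.inr_zero K

theorem rank_tangent_add_le (hS : StableMons J) (hJ : SaturatedMons J) (m : ℤ) :
    Module.rank K (tangentAtOrigin (markedIdeal (truncation J (m - 1)))) +
        ((Omega J m * Theta J m : ℕ) : Cardinal) ≤
      Module.rank K (tangentAtOrigin (markedIdeal (truncation J m))) := by
  classical
  let e : TangentIndex J m → Param (truncation J m) → K :=
    fun q => Pi.single (tangentParam q) 1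
  have he : LinearIndependent K e :=
    (Pi.linearIndependent_single_one (Param (truncation J m)) K).comp _
      (tangentParam_injective hJ)
  have hrank : Module.rank K (Submodule.span K (Set.range e)) =
      ((Omega J m * Theta J m : ℕ) : Cardinal) := by
    have hfin : Finite {β | β ∈ basisMons J ∧ (β.degree : ℤ) = m + 1 ∧ β 1 ≠ 0} :=
      ((finite_basisMons J).subset fun _ h => h.1).to_subtype
    have hfin' : Finite {α | α ∈ basisMons J ∧ (α.degree : ℤ) ≤ m - 1} :=
      ((finite_basisMons J).subset fun _ h => h.1).to_subtype
    rw [rank_span he, ← Cardinal.lift_inj.{u, 0}, Cardinal.mk_range_eq_of_injective he.injective,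
      ← Nat.cast_card, Omega, Theta, ← Nat.card_coe_set_eq, ← Nat.card_coe_set_eq,
      ← Nat.card_prod]
    simp
  -- One space vanishes on the cut parameters and the other is supported on them.
  have hdisj : cutTangent J m ⊓ Submodule.span K (Set.range e) = ⊥ := by
    rw [eq_bot_iff]
    rintro v ⟨hv, hv'⟩
    have hZ := (mem_cutTangent.1 hv).2
    have hout : ∀ p ∉ cutParams J m, v p = 0 := by
      clear hv hZ
      intro p hp
      induction hv' using Submodule.span_induction with
      | mem x hx =>
        obtain ⟨q, rfl⟩ := hx
        refine Pi.single_eq_of_ne ?_ 1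
        rintro rfl
        exact hp (tangentParam_mem_cutParams hJ q)
      | zero => rfl
      | add x y _ _ hx hy => rw [Pi.add_apply, hx, hy, add_zero]
      | smul a x _ hx => rw [Pi.smul_apply, hx, smul_zero]
    rw [Submodule.mem_bot]
    funext p
    by_cases hp : p ∈ cutParams J m
    · exact hZ p hp
    · exact hout p hp
  calc _ ≤ Module.rank K (cutTangent J m) + Module.rank K (Submodule.span K (Set.range e)) := by
        rw [hrank]
        exact add_le_add_left (rank_tangent_le_rank_cutTangent hS hJ m) _
    _ = Module.rank K ↥(cutTangent J m ⊔ Submodule.span K (Set.range e)) := by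
        rw [← Submodule.rank_sup_add_rank_inf_eq, hdisj, rank_bot, add_zero]
    _ ≤ _ := Submodule.rank_mono (sup_le inf_le_left (Submodule.span_le.2 (by
        rintro _ ⟨q, rfl⟩
        exact single_mem_tangentAtOrigin hS hJ q)))

end SpecialTangent

/-! ### Morphisms of affine schemes over a field -/

section Schemes

variable {K : Type u} [Field K] {R S T : Type u} [CommRing R] [Algebra K R] [CommRing S]
  [Algebra K S] [CommRing T] [Algebra K T]

theorem specOverMap_comp (f : R →ₐ[K] S) (g : S →ₐ[K] T) :
    specOverMap g ≫ specOverMap f = specOverMap (g.comp f) := by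
  refine Over.OverMorphism.ext ?_
  exact (Spec.map_comp (CommRingCat.ofHom f.toRingHom) (CommRingCat.ofHom g.toRingHom)).symm

theorem isClosedImmersion_specOverMap (f : R →ₐ[K] S) (hf : Function.Surjective f) :
    IsClosedImmersion (specOverMap f).left :=
  IsClosedImmersion.spec_of_surjective (CommRingCat.ofHom f.toRingHom) hf

theorem isIso_specOverMap_iff (f : R →ₐ[K] S) :
    IsIso (specOverMap f) ↔ Function.Bijective f := by
  have h : IsIso (specOverMap f).left ↔ Function.Bijective f :=
    isIso_SpecMap_iff (f := CommRingCat.ofHom f.toRingHom)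
  rw [← h]
  constructor
  · intro
    exact inferInstanceAs (IsIso ((Over.forget _).map (specOverMap f)))
  · intro h'
    have : IsIso ((Over.forget _).map (specOverMap f)) := h'
    exact isIso_of_reflects_iso (specOverMap f) (Over.forget _)

theorem exists_ringEquiv_of_iso (e : specOver K S ≅ specOver K R) : Nonempty (R ≃+* S) := by
  have h : IsIso e.hom.left := inferInstanceAs (IsIso ((Over.forget _).map e.hom))
  obtain ⟨f, hf⟩ : ∃ f : CommRingCat.of R ⟶ CommRingCat.of S, Spec.map f = e.hom.left :=
    ⟨Spec.preimage e.hom.left, Spec.map_preimage _⟩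
  have h' : IsIso (Spec.map f) := by
    rw [hf]
    exact h
  exact ⟨RingEquiv.ofBijective f.hom (isIso_SpecMap_iff.1 h')⟩

theorem smallEmb_eq {n : ℕ} (J : Ideal (MvPolynomial (Fin (n + 1)) K)) :
    smallEmb J = specOverMap ((Ideal.Quotient.mkₐ K (markedIdeal J)).comp
      (MvPolynomial.rename (Subtype.val : SParam J → Param J))) :=
  specOverMap_comp _ _

theorem isClosedImmersion_coordIncl {σ τ : Type} (ι : σ ↪ τ) :
    IsClosedImmersion (coordIncl K ι).left := by
  refine isClosedImmersion_specOverMap _ ?_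
  rw [← AlgHom.range_eq_top, eq_top_iff, ← MvPolynomial.adjoin_range_X, Algebra.adjoin_le_iff]
  rintro _ ⟨i, rfl⟩
  exact ⟨MvPolynomial.X (ι i), by simp [ι.injective.extend_apply]⟩

/-- A surjective endomorphism of a Noetherian ring is injective. -/
theorem injective_of_surjective_ringHom {R : Type*} [CommRing R] [IsNoetherianRing R]
    (f : R →+* R) (hf : Function.Surjective f) : Function.Injective f := by
  let F : ℕ →o Ideal R := ⟨fun k => RingHom.ker (f ^ k), monotone_nat_of_le_succ fun k x hx => by
    rw [RingHom.mem_ker] at hx ⊢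
    rw [pow_succ', RingHom.mul_def, RingHom.comp_apply, hx, map_zero]⟩
  obtain ⟨k, hk⟩ := monotone_stabilizes_iff_noetherian.2 ‹IsNoetherianRing R› F
  have hsurj : Function.Surjective (f ^ k) := by
    rw [RingHom.coe_pow]
    exact hf.iterate k
  rw [injective_iff_map_eq_zero]
  intro x hx
  obtain ⟨y, rfl⟩ := hsurj x
  have h1 : y ∈ F (k + 1) := by
    change (f ^ (k + 1)) y = 0
    rw [pow_succ', RingHom.mul_def, RingHom.comp_apply, hx]
  rw [← hk (k + 1) (Nat.le_succ k)] at h1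
  exact h1

end Schemes

/-! ### The morphism between the marked schemes of consecutive truncations -/

section Main

variable {K : Type u} [Field K] {n : ℕ} {J : Ideal (MvPolynomial (Fin (n + 1)) K)} {m : ℤ}

/-- The morphism `Mf(J_{≥ m-1}) ⟶ Mf(J_{≥ m})`. -/
def truncationMorphism (hS : StableMons J) (m : ℤ) :
    Mf (truncation J (m - 1)) ⟶ Mf (truncation J m) :=
  specOverMap (truncationHom hS m)

theorem truncationMorphism_comp_smallEmb (hS : StableMons J) (hJ : SaturatedMons J) (m : ℤ) :
    truncationMorphism hS m ≫ smallEmb (truncation J m) =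
      smallEmb (truncation J (m - 1)) ≫ coordIncl K (shiftSParam hJ m) := by
  rw [smallEmb_eq, smallEmb_eq, truncationMorphism, coordIncl]
  refine (specOverMap_comp _ _).trans (Eq.trans ?_ (specOverMap_comp _ _).symm)
  congr 1
  refine MvPolynomial.algHom_ext fun c => ?_
  let g (k : ℤ) : MvPolynomial (SParam (truncation J k)) K →ₐ[K] MfRing (truncation J k) :=
    (Ideal.Quotient.mkₐ K (markedIdeal (truncation J k))).comp
      (MvPolynomial.rename (Subtype.val : SParam (truncation J k) → Param (truncation J k)))
  have h1 : ∀ (k : ℤ) (d : SParam (truncation J k)),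
      g k (MvPolynomial.X d) = universalCoeffs _ d.1 := fun k d =>
    congrArg (Ideal.Quotient.mkₐ K _) (MvPolynomial.rename_X _ d)
  refine (congrArg (truncationHom hS m) (h1 m c)).trans (Eq.trans ?_
    (congrArg (g (m - 1)) (MvPolynomial.aeval_X (R := K) (Function.extend (shiftSParam hJ m)
      (MvPolynomial.X : _ → MvPolynomial (SParam (truncation J (m - 1))) K) 0) c)).symm)
  by_cases hc : c ∈ Set.range (shiftSParam hJ m)
  · obtain ⟨d, rfl⟩ := hc
    refine (truncationHom_shiftParam hS hJ d.1).trans (Eq.trans (h1 _ d).symm (congrArg (g (m - 1)) ?_))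
    exact ((shiftSParam hJ m).injective.extend_apply _ _ d).symm
  · refine (truncationHom_cutParams hS hJ ((mem_cutParams_iff hJ c).2 hc)).trans ?_
    refine Eq.trans (map_zero (g (m - 1))).symm (congrArg (g (m - 1)) ?_)
    exact (Function.extend_apply' _
      (0 : SParam (truncation J m) → MvPolynomial (SParam (truncation J (m - 1))) K) _ hc).symm

/-- Dually this is a pushout of rings: a cocone amounts to a homomorphism from the coordinate ring
of `Mf(J_{≥ m})` killing the cut parameters, and `exists_comp_truncationHom_eq` factors it. -/
theorem exists_isPullback_truncationMorphism (hS : StableMons J) (hJ : SaturatedMons J) (m : ℤ) :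
    ∃ p : Mf (truncation J (m - 1)) ⟶ closedSub (coordIdeal K (cutParams J m)),
      IsPullback p.left (truncationMorphism hS m).left
        (closedSubIncl (coordIdeal K (cutParams J m))).left (bigEmb (truncation J m)).left := by
  let q : (MvPolynomial (Param (truncation J m)) K ⧸ coordIdeal K (cutParams J m)) →ₐ[K]
      MfRing (truncation J (m - 1)) :=
    Ideal.Quotient.liftₐ _ ((truncationHom hS m).comp (Ideal.Quotient.mkₐ K _)) fun a ha => by
      have hle : coordIdeal K (cutParams J m) ≤
          RingHom.ker ((truncationHom hS m).comp (Ideal.Quotient.mkₐ K _)) := by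
        refine Ideal.span_le.2 ?_
        rintro _ ⟨z, hz, rfl⟩
        exact truncationHom_cutParams hS hJ hz
      exact hle ha
  have hq : ∀ a, q (Ideal.Quotient.mk _ a) =
      truncationHom hS m (Ideal.Quotient.mk _ a) := fun a => rfl
  refine ⟨specOverMap q, ?_⟩
  refine isPullback_SpecMap_of_isPushout
    (CommRingCat.ofHom (Ideal.Quotient.mkₐ K (coordIdeal K (cutParams J m))).toRingHom)
    (CommRingCat.ofHom (Ideal.Quotient.mkₐ K (markedIdeal (truncation J m))).toRingHom)
    (CommRingCat.ofHom q.toRingHom) (CommRingCat.ofHom (truncationHom hS m).toRingHom) ?_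
  refine ⟨⟨CommRingCat.hom_ext (RingHom.ext fun a => hq a)⟩, ⟨Limits.PushoutCocone.isColimitAux' _ fun s => ?_⟩⟩
  have hs : ∀ a, s.inl.hom (Ideal.Quotient.mk _ a) = s.inr.hom (Ideal.Quotient.mk _ a) := fun a =>
    congrArg (fun f => f.hom a) s.condition
  -- The cocone point is merely a ring; it gets the `K`-structure that makes `s.inr` a `K`-algebra
  -- map.
  letI : Algebra K s.pt := (s.inr.hom.comp (algebraMap K (MfRing (truncation J m)))).toAlgebra
  let g : MfRing (truncation J m) →ₐ[K] s.pt := { s.inr.hom with commutes' := fun _ => rfl }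
  have hg : ∀ p ∈ cutParams J m, g (universalCoeffs _ p) = 0 := fun p hp => by
    refine (hs (MvPolynomial.X p)).symm.trans ?_
    have h0 : (MvPolynomial.X p : MvPolynomial _ K) ∈ coordIdeal K (cutParams J m) :=
      Ideal.subset_span ⟨p, hp, rfl⟩
    rw [Ideal.Quotient.eq_zero_iff_mem.2 h0, map_zero]
  have hex := exists_comp_truncationHom_eq hS hJ g hg
  have hf : ∀ x, hex.choose (truncationHom hS m x) = s.inr.hom x :=
    fun x => DFunLike.congr_fun hex.choose_spec x
  refine ⟨CommRingCat.ofHom hex.choose.toRingHom, ?_, ?_, ?_⟩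
  · refine CommRingCat.hom_ext (RingHom.ext fun a => ?_)
    obtain ⟨a, rfl⟩ := Ideal.Quotient.mk_surjective a
    exact (hf _).trans (hs a).symm
  · exact CommRingCat.hom_ext (RingHom.ext fun a => hf a)
  · intro f _ h2
    refine CommRingCat.hom_ext (RingHom.ext fun x => ?_)
    obtain ⟨y, rfl⟩ := truncationHom_surjective hS hJ x
    exact (congrArg (fun f => f.hom y) h2).trans (hf y).symm

theorem exists_basisMons_degree_le (hM : IsMonomialIdeal J)
    (h : truncation J (m - 1) ≠ truncation J m) :
    ∃ α ∈ basisMons J, (α.degree : ℤ) ≤ m - 1 := by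
  by_contra! hcon
  apply h
  have hle : ∀ f ∈ J, ∀ γ : Mon n, f.coeff γ ≠ 0 → m ≤ γ.degree := by
    intro f hf γ hγ
    obtain ⟨s, hs⟩ := hM
    have h1 := hf
    rw [hs, MvPolynomial.mem_ideal_span_monomial_image] at h1
    obtain ⟨α, hα, hαγ⟩ := h1 γ (MvPolynomial.mem_support_iff.2 hγ)
    have hαJ : α ∈ mons J := by
      change _ ∈ J
      rw [hs]
      exact Ideal.subset_span ⟨α, hα, rfl⟩
    obtain ⟨β, hβ, hβα⟩ := exists_basisMons_le (mons_of_le hαJ hαγ)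
    have h2 := hcon β hβ
    have h3 := Finsupp.degree_mono hβα
    omega
  unfold truncation
  congr 1
  ext f
  constructor
  · rintro ⟨hf, d, hd, hh⟩
    by_cases h0 : f = 0
    -- The zero polynomial is homogeneous of every degree, so its degree may be chosen anew.
    · exact ⟨hf, m.toNat, Int.self_le_toNat m, h0 ▸ MvPolynomial.isHomogeneous_zero _ _ _⟩
    · obtain ⟨γ, hγ⟩ := MvPolynomial.ne_zero_iff.1 h0
      refine ⟨hf, d, ?_, hh⟩
      rw [← degree_eq_of_isHomogeneous hh hγ]
      exact hle f hf γ hγ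
  · rintro ⟨hf, d, hd, hh⟩
    exact ⟨hf, d, by omega, hh⟩

theorem truncationHom_bijective_iff (hM : IsMonomialIdeal J) (hS : StableMons J)
    (hJ : SaturatedMons J) :
    Function.Bijective (truncationHom hS m) ↔ (truncation J (m - 1) = truncation J m ∨
      ∀ α ∈ basisMons J, (α.degree : ℤ) = m + 1 → α 1 = 0) := by
  classical
  refine ⟨fun hb => ?_, truncationHom_bijective hS hJ⟩
  by_contra! hcon
  obtain ⟨hne, β, hβ, hβd, hβ1⟩ := hcon
  obtain ⟨α, hα, hαd⟩ := exists_basisMons_degree_le hM hne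
  let q : TangentIndex J m := (⟨β, hβ, hβd, hβ1⟩, ⟨α, hα, hαd⟩)
  -- Injectivity would make this cut parameter zero, but a deformation over the dual numbers sends
  -- it to `ε`.
  have h0 : universalCoeffs _ (tangentParam q) = 0 := hb.1 (by
    rw [truncationHom_cutParams hS hJ (tangentParam_mem_cutParams hJ q), map_zero])
  have h1 := aeval_eq_zero_of_mem_markedIdeal (hS.truncation m)
    (isMarkedBasis_tangentParam hS hJ (A := TrivSqZeroExt K K)
      (ε := TrivSqZeroExt.inr 1) (TrivSqZeroExt.inr_mul_inr K 1 1) q)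
    (Ideal.Quotient.eq_zero_iff_mem.1 h0)
  rw [MvPolynomial.aeval_X, if_pos rfl] at h1
  exact one_ne_zero (congrArg TrivSqZeroExt.snd h1)

/-- An abstract isomorphism composed with `truncationHom` is a surjective endomorphism of a
Noetherian ring, hence injective; so `truncationHom` is injective too. -/
theorem nonempty_iso_iff (hM : IsMonomialIdeal J) (hS : StableMons J)
    (hJ : SaturatedMons J) :
    Nonempty (Mf (truncation J (m - 1)) ≅ Mf (truncation J m)) ↔
      (truncation J (m - 1) = truncation J m ∨
        ∀ α ∈ basisMons J, (α.degree : ℤ) = m + 1 → α 1 = 0) := by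
  constructor
  · rintro ⟨e⟩
    obtain ⟨r⟩ := exists_ringEquiv_of_iso e
    refine (truncationHom_bijective_iff hM hS hJ).1 ⟨?_, truncationHom_surjective hS hJ⟩
    have h1 := injective_of_surjective_ringHom
      ((r.symm : MfRing (truncation J (m - 1)) →+* MfRing (truncation J m)).comp
        (truncationHom hS m).toRingHom)
      (r.symm.surjective.comp (truncationHom_surjective hS hJ))
    intro x y hxy
    exact h1 (congrArg r.symm hxy)
  · intro h
    have : IsIso (truncationMorphism hS m) :=
      (isIso_specOverMap_iff _).2 (truncationHom_bijective hS hJ h)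
    exact ⟨asIso (truncationMorphism hS m)⟩

theorem apply_one_eq_zero_of_rho_le (h : (rho J : ℤ) ≤ m) (α : Mon n) (hα : α ∈ basisMons J)
    (hd : (α.degree : ℤ) = m + 1) : α 1 = 0 := by
  by_contra h1
  have hfin : {d | ∃ α ∈ basisMons J, α 1 ≠ 0 ∧ α.degree = d}.Finite :=
    ((finite_basisMons J).image Finsupp.degree).subset (by
      rintro _ ⟨α, hα, -, rfl⟩
      exact ⟨α, hα, rfl⟩)
  have h2 : α.degree ≤ rho J := le_csSup hfin.bddAbove ⟨α, hα, h1, rfl⟩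
  omega

theorem nonempty_iso_of_rho_le (hM : IsMonomialIdeal J) (hS : StableMons J)
    (hJ : SaturatedMons J) (h : (rho J : ℤ) ≤ m) :
    Nonempty (Mf (truncation J ((rho J : ℤ) - 1)) ≅ Mf (truncation J m)) := by
  induction m, h using Int.leInduction with
  | base => exact (nonempty_iso_iff hM hS hJ).2 (Or.inr (apply_one_eq_zero_of_rho_le le_rfl))
  | succ k hk ih =>
    obtain ⟨e⟩ := ih
    obtain ⟨e'⟩ := (nonempty_iso_iff (m := k + 1) hM hS hJ).2
      (Or.inr (apply_one_eq_zero_of_rho_le (by omega)))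
    rw [add_sub_cancel_right] at e'
    exact ⟨e ≪≫ e'⟩

end Main

end Marked

end

/-! ### Assembly of the diagram, the tangent bound and the isomorphism criterion -/

theorem theorem5p8 {K : Type*} [Field K] [IsAlgClosed K] (n : ℕ)
    (J : Ideal (MvPolynomial (Fin (n + 1)) K))
    (hstable : Marked.StronglyStable J) (hsat : Marked.IsSaturated J) :
    (∀ m : ℤ,
      ∃ (ι : Marked.SParam (Marked.truncation J (m - 1)) ↪ Marked.SParam (Marked.truncation J m))
        (φ : Marked.Mf (Marked.truncation J (m - 1)) ⟶ Marked.Mf (Marked.truncation J m)),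
        -- the diagram of closed embeddings, for the identification of the parameters
        Marked.IsParamIdentification J m ι ∧
        IsClosedImmersion φ.left ∧
        IsClosedImmersion (Marked.smallEmb (Marked.truncation J (m - 1))).left ∧
        IsClosedImmersion (Marked.smallEmb (Marked.truncation J m)).left ∧
        IsClosedImmersion (Marked.coordIncl K ι).left ∧
        φ ≫ Marked.smallEmb (Marked.truncation J m) =
          Marked.smallEmb (Marked.truncation J (m - 1)) ≫ Marked.coordIncl K ι ∧
        -- the image of `φ` is cut out by a linear space lying over the one of the diagram
        (∃ Z : Set (Marked.Param (Marked.truncation J m)),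
          (∀ c : Marked.SParam (Marked.truncation J m), c.1 ∈ Z ↔ c ∉ Set.range ι) ∧
          ∃ p : Marked.Mf (Marked.truncation J (m - 1)) ⟶
              Marked.closedSub (Marked.coordIdeal K Z),
            IsPullback p.left φ.left
              (Marked.closedSubIncl (Marked.coordIdeal K Z)).left
              (Marked.bigEmb (Marked.truncation J m)).left) ∧
        -- the tangent spaces at the origin
        Module.rank K
            (Marked.tangentAtOrigin (Marked.markedIdeal (Marked.truncation J (m - 1)))) +
          ((Marked.Omega J m * Marked.Theta J m : ℕ) : Cardinal) ≤
        Module.rank K (Marked.tangentAtOrigin (Marked.markedIdeal (Marked.truncation J m))) ∧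
        -- the isomorphism criterion
        (IsIso φ ↔
          (Marked.truncation J (m - 1) = Marked.truncation J m ∨
            ∀ α ∈ Marked.basisMons J, (α.degree : ℤ) = m + 1 → α 1 = 0)) ∧
        (Nonempty (Marked.Mf (Marked.truncation J (m - 1)) ≅ Marked.Mf (Marked.truncation J m)) ↔
          (Marked.truncation J (m - 1) = Marked.truncation J m ∨
            ∀ α ∈ Marked.basisMons J, (α.degree : ℤ) = m + 1 → α 1 = 0))) ∧
    (∀ m : ℤ, (Marked.rho J : ℤ) ≤ m →
      Nonempty (Marked.Mf (Marked.truncation J ((Marked.rho J : ℤ) - 1)) ≅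
        Marked.Mf (Marked.truncation J m))) := by
  have hS := hstable.stableMons
  have hJ := hsat.saturatedMons hS
  have hM := hstable.1
  refine ⟨fun m => ⟨Marked.shiftSParam hJ m, Marked.truncationMorphism hS m,
    Marked.isParamIdentification_shiftSParam hJ m,
    Marked.isClosedImmersion_specOverMap _ (Marked.truncationHom_surjective hS hJ), ?_, ?_,
    Marked.isClosedImmersion_coordIncl _, Marked.truncationMorphism_comp_smallEmb hS hJ m,
    ⟨Marked.cutParams J m, Marked.mem_cutParams_iff hJ,
      Marked.exists_isPullback_truncationMorphism hS hJ m⟩,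
    Marked.rank_tangent_add_le hS hJ m,
    (Marked.isIso_specOverMap_iff _).trans (Marked.truncationHom_bijective_iff hM hS hJ),
    Marked.nonempty_iso_iff hM hS hJ⟩, fun m hm => Marked.nonempty_iso_of_rho_le hM hS hJ hm⟩
  · rw [Marked.smallEmb_eq]
    exact Marked.isClosedImmersion_specOverMap _ (Marked.superminimalHom_surjective hS hJ (m - 1))
  · rw [Marked.smallEmb_eq]
    exact Marked.isClosedImmersion_specOverMap _ (Marked.superminimalHom_surjective hS hJ m)
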